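/- Let $M$ be a smooth manifold (Hausdorff, second countable, of dimension $d$), regarded as a diffeological space whose plots are the usual smooth maps from open subsets of Euclidean spaces to $M$. Subsets, products and fibers of diffeological spaces carry the subspace and product diffeologies, and topological properties of diffeological spaces refer to the D-topology (the final topology with respect to all plots). A smooth map $\varphi\colon X\to Y$ of diffeological spaces is a *plotwise submersion* if for every $x\in X$, every plot $p\colon U\to Y$ and every $r\in U$ with $p(r)=\varphi(x)$, there are an open neighbourhood $V\subseteq U$ of $r$ and a plot $q\colon V\to X$ with $q(r)=x$ and $\varphi\circ q=p|_V$; it is a *local subduction* if it is moreover surjective. A *tepui fibration* over $M$ is a local subduction $\varphi\colon X\to M$ from a second-countable diffeological space $X$, all of whose fibers $\varphi^{-1}(m)$ are Hausdorff and second countable, such that for every $x\in X$ there is a plot $p\colon U\to X$ which is a plotwise submersion, has $x$ in its image, and is injective on $(\varphi p)^{-1}(\varphi(x))$. A *bundle of vector spaces* over $M$ is a smooth map $\pi\colon E\to M$ of diffeological spaces with real vector space structures on the fibers $E_m=\pi^{-1}(m)$ such that the zero section $M\to E$, the addition $E\times_M E\to E$ and the scalar multiplication $\mathbb{R}\times E\to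 E$ are smooth; morphisms are the smooth maps of total spaces over $\mathrm{id}_M$ that are linear on fibers. It is a *VB-tepui* if $\pi$ is a tepui fibration, and it has *globally bounded rank* if there is $N\in\mathbb{N}$ with $\dim E_m\le N$ for all $m\in M$. For a bundle of vector spaces $E$ over $M$ let $\Gamma(E)$ be the $C^\infty(M)$-module of smooth sections of $\pi$, and for a morphism $f\colon E\to E'$ let $\Gamma(f)=f_*\colon\Gamma(E)\to\Gamma(E')$, $\sigma\mapsto f\circ\sigma$. A $C^\infty(M)$-module $Q$ is *fiber-determined* if $0$ is the only element of $Q$ whose class in $Q/I_mQ$ vanishes for all $m\in M$, where $I_m\subseteq C^\infty(M)$ is the ideal of functions vanishing at $m$. **Proposition.** The section functor $\Gamma$ restricts to an equivalence of categories from the category of VB-tepui over $M$ of globally bounded rank (with all morphisms of bundles of vector spaces) to the category of finitely generated fiber-determined $C^\infty(M)$-modules (with all $C^\infty(M)$-linear maps). -/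

import Mathlib

open CategoryTheory Diffeology TopologicalSpace
open scoped Manifold ContDiff

universe u v w

noncomputable section

namespace Tepui

/-! ### Diffeological preliminaries

Diffeological spaces, plots `ℝⁿ → X`, smooth maps (`DSmooth`) and the D-topology (`dTopology`) are
those of Mathlib. -/

section Diffeology

variable {X : Type u} {Y : Type v}

/-- The diffeology induced on `X` by a map `f : X → Y`: a map `p` into `X` is a plot iff `f ∘ p` is a
plot of `Y`. -/
@[reducible]
def inducedDiffeology (f : X → Y) [DiffeologicalSpace Y] : DiffeologicalSpace X where
  plots _ := {p | IsPlot (f ∘ p)}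
  constant_plots x := isPlot_const (x := f x)
  plot_reparam hp hf := isPlot_reparam (X := Y) hp hf
  locality := fun {n} {p} h => DiffeologicalSpace.locality (X := Y) (p := f ∘ p) h

/-- The subspace diffeology. -/
instance subspaceDiffeology [DiffeologicalSpace X] (s : X → Prop) :
    DiffeologicalSpace {x // s x} :=
  inducedDiffeology Subtype.val

/-- The product diffeology: plots are the pairs of plots. -/
instance prodDiffeology [DiffeologicalSpace X] [DiffeologicalSpace Y] :
    DiffeologicalSpace (X × Y) where
  plots _ := {p | IsPlot (Prod.fst ∘ p) ∧ IsPlot (Prod.snd ∘ p)}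
  constant_plots x := ⟨isPlot_const (x := x.1), isPlot_const (x := x.2)⟩
  plot_reparam hp hf := ⟨isPlot_reparam hp.1 hf, isPlot_reparam hp.2 hf⟩
  locality := fun {n} {p} h =>
    ⟨DiffeologicalSpace.locality (X := X) (p := Prod.fst ∘ p) fun x =>
        let ⟨U, hU, hx, H⟩ := h x
        ⟨U, hU, hx, fun hf hf' => (H hf hf').1⟩,
      DiffeologicalSpace.locality (X := Y) (p := Prod.snd ∘ p) fun x =>
        let ⟨U, hU, hx, H⟩ := h x
        ⟨U, hU, hx, fun hf hf' => (H hf hf').2⟩⟩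

/-- The diffeology of a smooth `d`-dimensional manifold `M`: the plots are the maps into `M` that are
smooth in the usual sense. -/
@[reducible]
def manifoldDiffeology (d : ℕ) (M : Type u) [TopologicalSpace M]
    [ChartedSpace (EuclideanSpace ℝ (Fin d)) M] : DiffeologicalSpace M :=
  .ofCorePlotsOn
    { isPlotOn := fun {n U} _ p => ContMDiffOn (𝓡 n) (𝓡 d) ∞ p U
      isPlotOn_congr := fun _ _ _ h => ⟨fun H => H.congr h.symm, fun H => H.congr h⟩
      isPlot := fun {n} p => ContMDiff (𝓡 n) (𝓡 d) ∞ p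
      isPlotOn_univ := contMDiffOn_univ
      isPlot_const := fun _ => contMDiff_const
      isPlotOn_reparam := fun _ _ _ h hp hf => hp.comp hf.contMDiffOn h
      locality := fun _ _ h x hx => by
        obtain ⟨V, hV, hxV, H⟩ := h x hx
        exact ((H x hxV).contMDiffAt (hV.mem_nhds hxV)).contMDiffWithinAt }

variable [DiffeologicalSpace X] [DiffeologicalSpace Y]

/-- A smooth map `φ : X → Y` is a plotwise submersion if every plot `p : U → Y`, `U ⊆ ℝⁿ` open, with
`p r = φ x` lifts along `φ`, near `r`, to a plot `q` of `X` with `q r = x`. Here `U` carries the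
subspace diffeology, so that the plots with domain `U` are the smooth maps on `U`. -/
def IsPlotwiseSubmersion (φ : X → Y) : Prop :=
  DSmooth φ ∧
    ∀ (x : X) (n : ℕ) (U : Opens (EuclideanSpace ℝ (Fin n))) (p : U → Y) (r : U),
      DSmooth p → p r = φ x →
        ∃ (V : Opens (EuclideanSpace ℝ (Fin n))) (hVU : V ≤ U) (hr : (r : EuclideanSpace ℝ (Fin n)) ∈ V) (q : V → X),
          DSmooth q ∧ q ⟨r, hr⟩ = x ∧ ∀ t : V, φ (q t) = p ⟨t, hVU t.2⟩

/-- A local subduction is a surjective plotwise submersion. -/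
def IsLocalSubduction (φ : X → Y) : Prop :=
  IsPlotwiseSubmersion φ ∧ Function.Surjective φ

/-- The plot `p : U → X` is a minimal chart at `x` for `φ : X → Y`: its image contains `x`, it is a
plotwise submersion, and it is injective on the part of `U` lying over `φ x`. -/
def IsMinimalChartAt (φ : X → Y) (x : X) {n : ℕ} {U : Opens (EuclideanSpace ℝ (Fin n))}
    (p : U → X) : Prop :=
  DSmooth p ∧ x ∈ Set.range p ∧ IsPlotwiseSubmersion p ∧ Set.InjOn p {t | φ (p t) = φ x}

/-- Tepui fibrations `φ : X → Y`. The base `Y` is meant to be a smooth manifold, with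
`manifoldDiffeology`. Topological conditions refer to D-topologies, and fibers carry the subspace
diffeology. -/
structure IsTepuiFibration (φ : X → Y) : Prop where
  isLocalSubduction : IsLocalSubduction φ
  secondCountable : @SecondCountableTopology X dTopology
  exists_minimalChart : ∀ x : X, ∃ (n : ℕ) (U : Opens (EuclideanSpace ℝ (Fin n))) (p : U → X),
    IsMinimalChartAt φ x p
  fiber_t2 : ∀ y : Y, @T2Space {x // φ x = y} dTopology
  fiber_secondCountable : ∀ y : Y, @SecondCountableTopology {x // φ x = y} dTopology

end Diffeology

/-! ### Bundles of vector spaces -/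

/-- A diffeological bundle of vector spaces over a diffeological space `X`, given by its fibers, the
vector space structures on them, and a diffeology on the total space `Σ x, fiber x` for which
projection, zero section, fiberwise addition and scalar multiplication are smooth. No local
triviality is required. -/
structure VectorSpaceBundle (X : Type u) (dX : DiffeologicalSpace X) where
  fiber : X → Type v
  [addCommGroup : ∀ x, AddCommGroup (fiber x)]
  [module : ∀ x, Module ℝ (fiber x)]
  [diffeology : DiffeologicalSpace (Σ x, fiber x)]
  smooth_proj : DSmooth (fun e : Σ x, fiber x => e.1)
  smooth_zero : DSmooth (fun x : X => (⟨x, 0⟩ : Σ x, fiber x))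
  /-- The fiber product of the total space with itself is written as `Σ x, fiber x × fiber x`, with
  the diffeology that it has as a subset of the product of the total space with itself. -/
  smooth_add :
    letI : DiffeologicalSpace (Σ x, fiber x × fiber x) :=
      inducedDiffeology
        (fun e => ((⟨e.1, e.2.1⟩, ⟨e.1, e.2.2⟩) : (Σ x, fiber x) × (Σ x, fiber x)))
    DSmooth (fun e : Σ x, fiber x × fiber x => (⟨e.1, e.2.1 + e.2.2⟩ : Σ x, fiber x))
  smooth_smul :
    DSmooth (fun a : ℝ × (Σ x, fiber x) => (⟨a.2.1, a.1 • a.2.2⟩ : Σ x, fiber x))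

namespace VectorSpaceBundle

attribute [instance] addCommGroup module diffeology

section Category

variable {X : Type u} {dX : DiffeologicalSpace X}

/-- The total space. -/
abbrev Total (E : VectorSpaceBundle.{u, v} X dX) : Type (max u v) := Σ x, E.fiber x

/-- The projection of the total space to the base. -/
def proj (E : VectorSpaceBundle.{u, v} X dX) : E.Total → X := fun e => e.1

/-- A morphism of bundles of vector spaces over `X`: a smooth map of total spaces over the identity
of `X` that is linear on the fibers. -/
@[ext]
structure Hom (E E' : VectorSpaceBundle.{u, v} X dX) where
  toLinear : ∀ x, E.fiber x →ₗ[ℝ] E'.fiber x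
  smooth : DSmooth (fun e : E.Total => (⟨e.1, toLinear e.1 e.2⟩ : E'.Total))

instance : Category (VectorSpaceBundle.{u, v} X dX) where
  Hom := Hom
  id E := ⟨fun _ => LinearMap.id, dSmooth_id⟩
  comp f g := ⟨fun x => (g.toLinear x).comp (f.toLinear x), g.smooth.comp f.smooth⟩

/-- The dimensions of the fibers are bounded by one natural number. -/
def HasBoundedRank (E : VectorSpaceBundle.{u, v} X dX) : Prop :=
  ∃ N : ℕ, ∀ x, Module.rank ℝ (E.fiber x) ≤ N

end Category

end VectorSpaceBundle

/-! ### Sections and modules over a manifold -/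

section Manifold

variable (d : ℕ) (M : Type u) [TopologicalSpace M] [ChartedSpace (EuclideanSpace ℝ (Fin d)) M]

/-- Bundles of vector spaces over the manifold `M`. -/
abbrev BundleOver : Type (max u (v + 1)) :=
  VectorSpaceBundle.{u, v} M (manifoldDiffeology d M)

variable {d M}

/-- A bundle of vector spaces over `M` is a VB-tepui if its projection is a tepui fibration. -/
def IsVBTepui (E : BundleOver.{u, v} d M) : Prop :=
  letI := manifoldDiffeology d M
  IsTepuiFibration E.proj

/-- A section `s` of `E` is smooth if it is smooth as a map from `M` to the total space. -/
def IsSmoothSection (E : BundleOver.{u, v} d M) (s : ∀ m, E.fiber m) : Prop :=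
  letI := manifoldDiffeology d M
  DSmooth (fun m : M => (⟨m, s m⟩ : E.Total))

/-- The type `Γ(E)` of smooth sections of `E`. -/
def SmoothSection (E : BundleOver.{u, v} d M) : Type (max u v) :=
  {s : ∀ m, E.fiber m // IsSmoothSection E s}

namespace SmoothSection

variable {E : BundleOver.{u, v} d M}

theorem isSmoothSection_zero : IsSmoothSection E 0 :=
  E.smooth_zero

theorem isSmoothSection_add {s t : ∀ m, E.fiber m} (hs : IsSmoothSection E s)
    (ht : IsSmoothSection E t) : IsSmoothSection E (s + t) := by
  intro n p hp
  let : DiffeologicalSpace (Σ x, E.fiber x × E.fiber x) :=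
    inducedDiffeology (fun e => ((⟨e.1, e.2.1⟩, ⟨e.1, e.2.2⟩) : E.Total × E.Total))
  exact E.smooth_add n (fun r => ⟨p r, s (p r), t (p r)⟩) ⟨hs n p hp, ht n p hp⟩

theorem isSmoothSection_smul (f : C^∞⟮𝓡 d, M; ℝ⟯) {s : ∀ m, E.fiber m}
    (hs : IsSmoothSection E s) : IsSmoothSection E (fun m => f m • s m) := by
  intro n p hp
  have hfp : IsPlot (f ∘ p) := by
    have hp' : ContMDiff (𝓡 n) (𝓡 d) ∞ p := hp
    exact (f.contMDiff.comp hp').contDiff.isPlot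
  exact E.smooth_smul n (fun r => (f (p r), ⟨p r, s (p r)⟩)) ⟨hfp, hs n p hp⟩

instance : Zero (SmoothSection E) := ⟨⟨0, isSmoothSection_zero⟩⟩

instance : Add (SmoothSection E) := ⟨fun s t => ⟨s.1 + t.1, isSmoothSection_add s.2 t.2⟩⟩

/-- Smooth functions act on smooth sections pointwise. -/
instance : SMul C^∞⟮𝓡 d, M; ℝ⟯ (SmoothSection E) :=
  ⟨fun f s => ⟨fun m => f m • s.1 m, isSmoothSection_smul f s.2⟩⟩

instance : Neg (SmoothSection E) :=
  ⟨fun s => ⟨-s.1, by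
    have h := isSmoothSection_smul (-1 : C^∞⟮𝓡 d, M; ℝ⟯) s.2
    have e : (fun m => (-1 : C^∞⟮𝓡 d, M; ℝ⟯) m • s.1 m) = -s.1 := by
      funext m
      change (-1 : ℝ) • s.1 m = -(s.1 m)
      simp
    rwa [e] at h⟩⟩

instance : AddCommGroup (SmoothSection E) where
  add_assoc a b c := Subtype.ext (add_assoc a.1 b.1 c.1)
  zero_add a := Subtype.ext (zero_add a.1)
  add_zero a := Subtype.ext (add_zero a.1)
  add_comm a b := Subtype.ext (add_comm a.1 b.1)
  neg_add_cancel a := Subtype.ext (neg_add_cancel a.1)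
  nsmul := nsmulRec
  zsmul := zsmulRec

instance : Module C^∞⟮𝓡 d, M; ℝ⟯ (SmoothSection E) where
  one_smul s := Subtype.ext (funext fun m => one_smul ℝ (s.1 m))
  mul_smul f g s := Subtype.ext (funext fun m => mul_smul (f m) (g m) (s.1 m))
  smul_zero f := Subtype.ext (funext fun m => smul_zero (f m))
  smul_add f s t := Subtype.ext (funext fun m => smul_add (f m) (s.1 m) (t.1 m))
  add_smul f g s := Subtype.ext (funext fun m => add_smul (f m) (g m) (s.1 m))
  zero_smul s := Subtype.ext (funext fun m => zero_smul ℝ (s.1 m))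

end SmoothSection

/-- The map `f_* : Γ(E) → Γ(E')` induced by a morphism `f : E → E'`. -/
def pushforward {E E' : BundleOver.{u, v} d M} (f : E ⟶ E') :
    SmoothSection E →ₗ[C^∞⟮𝓡 d, M; ℝ⟯] SmoothSection E' where
  toFun s := ⟨fun m => f.toLinear m (s.1 m), fun n p hp => f.smooth n _ (s.2 n p hp)⟩
  map_add' s t := Subtype.ext (funext fun m => (f.toLinear m).map_add (s.1 m) (t.1 m))
  map_smul' g s := Subtype.ext (funext fun m => (f.toLinear m).map_smul (g m) (s.1 m))

variable (d M)

/-- The section functor `Γ`. -/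
def sectionFunctor : BundleOver.{u, v} d M ⥤ ModuleCat.{max u v} C^∞⟮𝓡 d, M; ℝ⟯ where
  obj E := ModuleCat.of _ (SmoothSection E)
  map f := ModuleCat.ofHom (pushforward f)

variable {M}

/-- The ideal `I_m` of smooth functions vanishing at `m`. -/
def vanishingIdeal (m : M) : Ideal C^∞⟮𝓡 d, M; ℝ⟯ :=
  RingHom.ker (ContMDiffMap.evalRingHom m)

variable {d}

/-- An element `q` of a `C^∞(M)`-module `Q` is invisible if its class in `Q / I_m Q` is zero for all
`m`. -/
def IsInvisible {Q : Type w} [AddCommGroup Q] [Module C^∞⟮𝓡 d, M; ℝ⟯ Q] (q : Q) : Prop :=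
  ∀ m : M, (vanishingIdeal d m • (⊤ : Submodule C^∞⟮𝓡 d, M; ℝ⟯ Q)).mkQ q = 0

variable (d M)

/-- A `C^∞(M)`-module is fiber-determined if zero is its only invisible element. -/
def IsFiberDetermined (Q : Type w) [AddCommGroup Q] [Module C^∞⟮𝓡 d, M; ℝ⟯ Q] : Prop :=
  ∀ q : Q, IsInvisible (d := d) (M := M) q → q = 0

/-- The objects of the category of VB-tepui over `M` of globally bounded rank. -/
def boundedVBTepui : ObjectProperty (BundleOver.{u, v} d M) :=
  fun E => IsVBTepui E ∧ E.HasBoundedRank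

/-- The objects of the category of finitely generated fiber-determined `C^∞(M)`-modules. -/
def finiteFiberDetermined : ObjectProperty (ModuleCat.{w} C^∞⟮𝓡 d, M; ℝ⟯) :=
  fun Q => Module.Finite C^∞⟮𝓡 d, M; ℝ⟯ Q ∧ IsFiberDetermined d M Q

end Manifold

end Tepui

end

/-!
The section functor is an equivalence because a VB-tepui `E` is recovered from finitely many of
its sections, and a finitely generated module is recovered from its fibers `Q / I_m Q` if it is
fiber-determined.

Every vector of `E` is a value of a section (`exists_section_through`), since plots of `M` lift
along `π`. The crucial fact is that sections `σ i` whose values span the fiber `E_m` generate all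
plots of `E` over a neighbourhood of `m`, with smooth coefficients (`eventually_generatesAt`). To
see this, consider a minimal chart `C` at the zero vector over `m`. The map
`Φ(x, τ) = ∑ τ i • σ i x` lifts to a map `g` into the domain of `C`, and if `g` is a
submersion, then a right inverse of `g` expresses `C`, hence every
plot near the zero vector, through `Φ`; other plots are first scaled down. That `g` is a
submersion (`surjective_fderiv_of_linear_lift`) uses minimality: over
`m`, the chart is an injective parametrization `ρ` of a part of `E_m`, so that scaling and
addition lift to smooth maps of its parameters. The mixed second derivative at zero of the lift
`K(t, b)` of scaling is the identity, by comparison with the lift of doubling, and it takes values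
in the range of the derivative of `g`, because scaling factors through `Φ`. The symmetry of second
derivatives gives surjectivity.

It follows that linear maps `Γ(E) → Γ(E')` act fiberwise, so that `Γ` is full and faithful
(`pushforward_surjective`, `pushforward_injective`). If the rank is bounded by `N`, a cover of `M`
in `d + 1` colours, with disjoint sets in each colour (`exists_colored_cover`), allows
`(d + 1) * N` sections to generate `E` everywhere, so that `Γ(E)` is finitely generated
(`finite_smoothSection`). It is fiber-determined because evaluation at `m` factors through
`Γ(E) / I_m Γ(E)`.

Conversely, the fibers `Q / I_m Q` of a finitely generated module form a bundle `fiberBundle`,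
whose plots are locally combinations of the classes of the generators with smooth coefficients. By
Nakayama's lemma, a basis of the fiber at `m` lifts to elements that generate `Q` near `m`, and
with the lifting of coefficients (`exists_coeff_of_locallySpans`) it yields a minimal chart at all
vectors over `m`; so the bundle is a VB-tepui of bounded rank (`isVBTepui_fiberBundle`). Its
module of sections is `Q` if `Q` is fiber-determined (`bijective_toSection`).
-/

noncomputable section

namespace Tepui

open Set Filter Topology

/-! ### Germs of plots -/

section Germs

variable {V : Type*} [NormedAddCommGroup V] [NormedSpace ℝ V]
  {W : Type*} [NormedAddCommGroup W] [NormedSpace ℝ W]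
  {Z : Type*} [NormedAddCommGroup Z] [NormedSpace ℝ Z]
  {X : Type*} [DiffeologicalSpace X] {Y : Type*} [DiffeologicalSpace Y]

/-- The map `φ` between normed spaces is smooth on a neighbourhood of `v`. For the smoothness
exponent `∞` this is stronger than `ContDiffAt ℝ ∞ φ v`. -/
def ContDiffNear (φ : V → W) (v : V) : Prop := ∀ᶠ y in 𝓝 v, ContDiffAt ℝ ∞ φ y

/-- The map `f`, defined on a normed space `V`, restricts to a smooth map from a neighbourhood of
`v` to the diffeological space `X`. -/
def IsPlotAt (f : V → X) (v : V) : Prop :=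
  ∃ O : Set V, IsOpen O ∧ v ∈ O ∧ ∀ (n : ℕ) (c : EuclideanSpace ℝ (Fin n) → V),
    ContDiff ℝ ∞ c → (∀ s, c s ∈ O) → IsPlot (f ∘ c)

theorem ContDiffNear.contDiffAt {φ : V → W} {v : V} (h : ContDiffNear φ v) :
    ContDiffAt ℝ ∞ φ v := h.self_of_nhds

theorem ContDiffNear.eventually {φ : V → W} {v : V} (h : ContDiffNear φ v) :
    ∀ᶠ y in 𝓝 v, ContDiffNear φ y := eventually_eventually_nhds.2 h

theorem _root_.ContDiff.contDiffNear {φ : V → W} (h : ContDiff ℝ ∞ φ) (v : V) :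
    ContDiffNear φ v := Eventually.of_forall fun _ => h.contDiffAt

theorem ContDiffNear.congr {φ ψ : V → W} {v : V} (h : ContDiffNear φ v) (e : ψ =ᶠ[𝓝 v] φ) :
    ContDiffNear ψ v := by
  filter_upwards [h, eventually_eventuallyEq_nhds.2 e] with y hy ey
  exact hy.congr_of_eventuallyEq ey

theorem ContDiffNear.comp {g : W → Z} {φ : V → W} {v : V} (hg : ContDiffNear g (φ v))
    (hφ : ContDiffNear φ v) : ContDiffNear (g ∘ φ) v := by
  filter_upwards [hφ, hφ.contDiffAt.continuousAt.eventually hg] with y h1 h2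
  exact h2.comp y h1

theorem ContDiffNear.prodMk {f : V → W} {g : V → Z} {v : V} (hf : ContDiffNear f v)
    (hg : ContDiffNear g v) : ContDiffNear (fun x => (f x, g x)) v := by
  filter_upwards [hf, hg] with y h1 h2
  exact h1.prodMk h2

theorem ContDiffNear.continuousAt {φ : V → W} {v : V} (h : ContDiffNear φ v) :
    ContinuousAt φ v := h.contDiffAt.continuousAt

theorem exists_equiv_euclideanSpace (V : Type*) [NormedAddCommGroup V] [NormedSpace ℝ V]
    [FiniteDimensional ℝ V] : ∃ n : ℕ, Nonempty (V ≃L[ℝ] EuclideanSpace ℝ (Fin n)) :=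
  ⟨Module.finrank ℝ V, ⟨ContinuousLinearEquiv.ofFinrankEq (by simp)⟩⟩

/-- A neighbourhood of a point contains the image of a smooth self-map that is the identity near the
point. It turns germs into globally defined maps. -/
theorem exists_contDiff_eventuallyEq_id [FiniteDimensional ℝ V] {O : Set V} {v : V}
    (hO : O ∈ 𝓝 v) : ∃ ρ : V → V, ContDiff ℝ ∞ ρ ∧ (∀ x, ρ x ∈ O) ∧ ρ =ᶠ[𝓝 v] id := by
  obtain ⟨ε, hε, hεO⟩ := Metric.mem_nhds_iff.1 hO
  let χ : ContDiffBump v := ⟨ε / 2, ε, by positivity, by linarith⟩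
  refine ⟨fun x => v + χ x • (x - v), ?_, fun x => hεO ?_, ?_⟩
  · exact contDiff_const.add (χ.contDiff.smul (contDiff_id.sub contDiff_const))
  · rw [Metric.mem_ball, dist_eq_norm, add_sub_cancel_left, norm_smul, Real.norm_of_nonneg χ.nonneg]
    by_cases hx : x ∈ Metric.ball v ε
    · rw [Metric.mem_ball, dist_eq_norm] at hx
      have h1 : χ x * ‖x - v‖ ≤ 1 * ‖x - v‖ :=
        mul_le_mul_of_nonneg_right χ.le_one (norm_nonneg _)
      linarith
    · have : χ x = 0 := by
        rw [← Function.notMem_support, χ.support_eq]; exact hx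
      simpa [this] using hε
  · filter_upwards [χ.eventuallyEq_one] with x hx
    simp [hx]

theorem IsPlotAt.congr {f g : V → X} {v : V} (h : IsPlotAt f v) (e : g =ᶠ[𝓝 v] f) :
    IsPlotAt g v := by
  obtain ⟨O, hO, hv, H⟩ := h
  obtain ⟨O', hO'e, hO', hv'⟩ := eventually_nhds_iff.1 e
  refine ⟨O ∩ O', hO.inter hO', ⟨hv, hv'⟩, fun n c hc hcO => ?_⟩
  have : g ∘ c = f ∘ c := funext fun s => hO'e _ (hcO s).2
  rw [this]
  exact H n c hc fun s => (hcO s).1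

theorem IsPlotAt.eventually {f : V → X} {v : V} (h : IsPlotAt f v) :
    ∀ᶠ w in 𝓝 v, IsPlotAt f w := by
  obtain ⟨O, hO, hv, H⟩ := h
  filter_upwards [hO.mem_nhds hv] with w hw using ⟨O, hO, hw, H⟩

theorem IsPlotAt.comp {f : W → X} {φ : V → W} {v : V} (hf : IsPlotAt f (φ v))
    (hφ : ContDiffNear φ v) : IsPlotAt (f ∘ φ) v := by
  obtain ⟨O, hO, hv, H⟩ := hf
  have h1 : ∀ᶠ y in 𝓝 v, ContDiffAt ℝ ∞ φ y ∧ φ y ∈ O :=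
    hφ.and (hφ.continuousAt.eventually (hO.mem_nhds hv))
  obtain ⟨O', hO'e, hO', hv'⟩ := eventually_nhds_iff.1 h1
  refine ⟨O', hO', hv', fun n c hc hcO => ?_⟩
  refine H n (φ ∘ c) ?_ fun s => (hO'e _ (hcO s)).2
  exact contDiff_iff_contDiffAt.2 fun s => (hO'e _ (hcO s)).1.comp s hc.contDiffAt

theorem IsPlotAt.comp_of_eq {f : W → X} {φ : V → W} {v : V} {w : W} (hf : IsPlotAt f w)
    (hφ : ContDiffNear φ v) (e : φ v = w) : IsPlotAt (fun x => f (φ x)) v := by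
  subst e; exact hf.comp hφ

theorem _root_.Diffeology.DSmooth.comp_isPlotAt {F : X → Y} (hF : DSmooth F) {f : V → X} {v : V}
    (hf : IsPlotAt f v) : IsPlotAt (fun w => F (f w)) v := by
  obtain ⟨O, hO, hv, H⟩ := hf
  exact ⟨O, hO, hv, fun n c hc hcO => hF n _ (H n c hc hcO)⟩

theorem _root_.Diffeology.IsPlot.isPlotAt {n : ℕ} {P : EuclideanSpace ℝ (Fin n) → X} (hP : IsPlot P)
    (r : EuclideanSpace ℝ (Fin n)) : IsPlotAt P r :=
  ⟨univ, isOpen_univ, mem_univ _, fun _ _ hc _ => isPlot_reparam hP hc⟩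

theorem isPlot_of_isPlotAt {n : ℕ} {P : EuclideanSpace ℝ (Fin n) → X}
    (h : ∀ r, IsPlotAt P r) : IsPlot P :=
  DiffeologicalSpace.locality fun r => by
    obtain ⟨O, hO, hv, H⟩ := h r
    exact ⟨O, hO, hv, fun hf hc => H _ _ hc hf⟩

theorem IsPlotAt.exists_isPlot {n : ℕ} {f : EuclideanSpace ℝ (Fin n) → X}
    {r : EuclideanSpace ℝ (Fin n)} (hf : IsPlotAt f r) :
    ∃ P : EuclideanSpace ℝ (Fin n) → X, IsPlot P ∧ f =ᶠ[𝓝 r] P := by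
  obtain ⟨O, hO, hv, H⟩ := hf
  obtain ⟨ρ, h1, h2, h3⟩ := exists_contDiff_eventuallyEq_id (hO.mem_nhds hv)
  refine ⟨f ∘ ρ, H n ρ h1 h2, ?_⟩
  filter_upwards [h3] with s hs
  simp [hs]

theorem isPlotAt_iff_contDiffNear [FiniteDimensional ℝ V] [DiffeologicalSpace W]
    [IsContDiffCompatible W] {f : V → W} {v : V} : IsPlotAt f v ↔ ContDiffNear f v := by
  constructor
  · rintro ⟨O, hO, hv, H⟩
    obtain ⟨n, ⟨e⟩⟩ := exists_equiv_euclideanSpace V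
    filter_upwards [hO.mem_nhds hv] with y hy
    obtain ⟨ρ, h1, h2, h3⟩ := exists_contDiff_eventuallyEq_id (hO.mem_nhds hy)
    have h4 := (H n (ρ ∘ e.symm) (h1.comp e.symm.contDiff) fun s => h2 _).contDiff
    have h5 : ContDiff ℝ ∞ (f ∘ ρ) := by
      have : f ∘ ρ = (f ∘ ρ ∘ e.symm) ∘ e := by ext; simp
      rw [this]
      exact h4.comp e.contDiff
    refine h5.contDiffAt.congr_of_eventuallyEq ?_
    filter_upwards [h3] with s hs
    simp [hs]
  · intro h
    obtain ⟨O, hOe, hO, hv⟩ := eventually_nhds_iff.1 h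
    refine ⟨O, hO, hv, fun n c hc hcO => ContDiff.isPlot ?_⟩
    exact contDiff_iff_contDiffAt.2 fun s => (hOe _ (hcO s)).comp s hc.contDiffAt

theorem isPlotAt_prod_iff {f : V → X × Y} {v : V} :
    IsPlotAt f v ↔ IsPlotAt (fun w => (f w).1) v ∧ IsPlotAt (fun w => (f w).2) v := by
  constructor
  · rintro ⟨O, hO, hv, H⟩
    exact ⟨⟨O, hO, hv, fun n c hc hcO => (H n c hc hcO).1⟩,
      ⟨O, hO, hv, fun n c hc hcO => (H n c hc hcO).2⟩⟩
  · rintro ⟨⟨O, hO, hv, H⟩, ⟨O', hO', hv', H'⟩⟩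
    exact ⟨O ∩ O', hO.inter hO', ⟨hv, hv'⟩, fun n c hc hcO =>
      ⟨H n c hc fun s => (hcO s).1, H' n c hc fun s => (hcO s).2⟩⟩

theorem isPlotAt_induced_iff {A : Type*} {F : A → X} {f : V → A} {v : V} :
    @IsPlotAt V _ _ A (inducedDiffeology F) f v ↔ IsPlotAt (fun w => F (f w)) v := Iff.rfl

theorem isPlotAt_manifold_iff {d : ℕ} {M : Type*} [TopologicalSpace M]
    [ChartedSpace (EuclideanSpace ℝ (Fin d)) M] [FiniteDimensional ℝ V] {f : V → M} {v : V} :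
    @IsPlotAt V _ _ M (manifoldDiffeology d M) f v ↔
      ∀ᶠ w in 𝓝 v, ContMDiffAt 𝓘(ℝ, V) (𝓡 d) ∞ f w := by
  constructor
  · rintro ⟨O, hO, hv, H⟩
    obtain ⟨n, ⟨e⟩⟩ := exists_equiv_euclideanSpace V
    filter_upwards [hO.mem_nhds hv] with y hy
    obtain ⟨ρ, h1, h2, h3⟩ := exists_contDiff_eventuallyEq_id (hO.mem_nhds hy)
    have h4 : ContMDiff (𝓡 n) (𝓡 d) ∞ (f ∘ ρ ∘ e.symm) :=
      H n (ρ ∘ e.symm) (h1.comp e.symm.contDiff) fun s => h2 _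
    have h5 : ContMDiff 𝓘(ℝ, V) (𝓡 d) ∞ (f ∘ ρ) := by
      have : f ∘ ρ = (f ∘ ρ ∘ e.symm) ∘ e := by ext; simp
      rw [this]
      exact h4.comp e.contDiff.contMDiff
    refine h5.contMDiffAt.congr_of_eventuallyEq ?_
    filter_upwards [h3] with s hs
    simp [hs]
  · intro h
    obtain ⟨O, hOe, hO, hv⟩ := eventually_nhds_iff.1 h
    refine ⟨O, hO, hv, fun n c hc hcO => ?_⟩
    exact fun s => (hOe _ (hcO s)).comp s hc.contMDiff.contMDiffAt

variable {n : ℕ} {U : Opens (EuclideanSpace ℝ (Fin n))}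

theorem isPlotAt_opens_iff [FiniteDimensional ℝ V] {g : V → U} {v : V} :
    IsPlotAt g v ↔ ContDiffNear (fun w => (g w : EuclideanSpace ℝ (Fin n))) v :=
  (isPlotAt_induced_iff (F := (Subtype.val : U → EuclideanSpace ℝ (Fin n)))).trans
    isPlotAt_iff_contDiffNear

/-- A plot defined on an open subset is a germ of a plot at each point of that subset. -/
theorem isPlotAt_of_dSmooth_opens {p : U → X} (hp : DSmooth p) {f : EuclideanSpace ℝ (Fin n) → X}
    (hf : ∀ t : U, f t = p t) {r : EuclideanSpace ℝ (Fin n)} (hr : r ∈ U) : IsPlotAt f r := by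
  refine ⟨U, U.2, hr, fun k c hc hcU => ?_⟩
  have h1 : f ∘ c = p ∘ fun s => (⟨c s, hcU s⟩ : U) := funext fun s => hf ⟨c s, hcU s⟩
  rw [h1]
  exact hp k _ (show IsPlot (Subtype.val ∘ fun s => (⟨c s, hcU s⟩ : U)) from hc.isPlot)

theorem dSmooth_opens_of_isPlotAt {f : EuclideanSpace ℝ (Fin n) → X} (hf : ∀ t ∈ U, IsPlotAt f t) :
    DSmooth (fun t : U => f t) := by
  intro k c hc
  refine isPlot_of_isPlotAt fun r => ?_
  have : IsPlot (fun s => (c s : EuclideanSpace ℝ (Fin n))) := hc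
  exact IsPlotAt.comp_of_eq (f := f) (hf _ (c r).2) (this.contDiff.contDiffNear r) rfl

/-- Lifting of germs of plots along a plotwise submersion. -/
theorem IsPlotwiseSubmersion.exists_lift [FiniteDimensional ℝ V] {φ : X → Y}
    (hφ : IsPlotwiseSubmersion φ) {f : V → Y} {v : V} (hf : IsPlotAt f v) {x : X}
    (hx : f v = φ x) : ∃ q : V → X, IsPlotAt q v ∧ q v = x ∧ ∀ᶠ w in 𝓝 v, φ (q w) = f w := by
  classical
  obtain ⟨n, ⟨e⟩⟩ := exists_equiv_euclideanSpace V
  have hf' : IsPlotAt (fun s => f (e.symm s)) (e v) :=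
    hf.comp_of_eq (e.symm.contDiff.contDiffNear _) (by simp)
  obtain ⟨O, hO, hv, H⟩ := hf'
  let U : Opens (EuclideanSpace ℝ (Fin n)) := ⟨O, hO⟩
  obtain ⟨V', hVU, hr, q, hq, hqr, hqp⟩ := hφ.2 x n U (fun t => f (e.symm t)) ⟨e v, hv⟩
    (dSmooth_opens_of_isPlotAt (f := fun s => f (e.symm s)) fun t ht => ⟨O, hO, ht, H⟩)
    (by simpa using hx)
  let q' : EuclideanSpace ℝ (Fin n) → X := fun s => if h : s ∈ V' then q ⟨s, h⟩ else x
  have hq' : ∀ t : V', q' t = q t := fun t => by simp [q']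
  refine ⟨fun w => q' (e w), ?_, ?_, ?_⟩
  · exact IsPlotAt.comp_of_eq (f := q') (isPlotAt_of_dSmooth_opens hq hq' hr)
      (e.contDiff.contDiffNear v) rfl
  · exact (hq' ⟨e v, hr⟩).trans hqr
  · filter_upwards [e.continuous.continuousAt.eventually (V'.2.mem_nhds hr)] with w hw
    have := hqp ⟨e w, hw⟩
    rw [← hq'] at this
    simpa using this

/-- A criterion for plotwise submersions in terms of germs. -/
theorem isPlotwiseSubmersion_of_exists_lift {φ : X → Y} (hφ : DSmooth φ)
    (h : ∀ (x : X) (n : ℕ) (f : EuclideanSpace ℝ (Fin n) → Y) (r : EuclideanSpace ℝ (Fin n)),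
      IsPlotAt f r → f r = φ x →
        ∃ q : EuclideanSpace ℝ (Fin n) → X, IsPlotAt q r ∧ q r = x ∧ ∀ᶠ t in 𝓝 r, φ (q t) = f t) :
    IsPlotwiseSubmersion φ := by
  classical
  refine ⟨hφ, fun x n U p r hp hpr => ?_⟩
  let f : EuclideanSpace ℝ (Fin n) → Y := fun t => if h : t ∈ U then p ⟨t, h⟩ else p r
  have hf : ∀ t : U, f t = p t := fun t => by simp [f]
  obtain ⟨q, hq, hqr, hqf⟩ := h x n f r (isPlotAt_of_dSmooth_opens hp hf r.2) ((hf r).trans hpr)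
  obtain ⟨O, hO', hO, hr⟩ := eventually_nhds_iff.1
    ((hq.eventually.and hqf).and (U.2.mem_nhds r.2))
  refine ⟨⟨O, hO⟩, fun t ht => (hO' t ht).2, hr, fun t => q t,
    dSmooth_opens_of_isPlotAt fun t ht => (hO' t ht).1.1, hqr, fun t => ?_⟩
  rw [(hO' t t.2).1.2, ← hf]

theorem IsPlotAt.eventually_mem [FiniteDimensional ℝ V] {f : V → X} {v : V} (hf : IsPlotAt f v)
    {A : Set X} (hA : IsOpen[dTopology] A) (hv : f v ∈ A) : ∀ᶠ w in 𝓝 v, f w ∈ A := by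
  obtain ⟨n, ⟨e⟩⟩ := exists_equiv_euclideanSpace V
  have h1 : IsPlotAt (fun s => f (e.symm s)) (e v) :=
    hf.comp_of_eq (e.symm.contDiff.contDiffNear _) (by simp)
  obtain ⟨P, hP, hPf⟩ := h1.exists_isPlot
  have h2 : P ⁻¹' A ∈ 𝓝 (e v) := by
    refine (isOpen_iff_preimages_plots.1 hA n P hP).mem_nhds ?_
    rw [mem_preimage, ← hPf.self_of_nhds]
    simpa using hv
  filter_upwards [e.continuous.continuousAt.eventually (hPf.and h2)] with w hw
  have h3 : f w = P (e w) := by simpa using hw.1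
  rw [h3]
  exact hw.2

end Germs

/-! ### Vector space operations in a smooth parametrization -/

section VectorSpaceChart

variable {T : Type*} {B : Type*} [NormedAddCommGroup B] {ρ : B → T} {N : Set B}

/-- Lifts along an injective parametrization are unique near a point that they map to zero. -/
theorem eventually_eq_of_injOn {V : Type*} [TopologicalSpace V] {v : V} (hN : N ∈ 𝓝 (0 : B))
    (hρ : InjOn ρ N) {f g : V → B} (hf : ContinuousAt f v) (hg : ContinuousAt g v) (hf0 : f v = 0)
    (hg0 : g v = 0) (h : ∀ᶠ x in 𝓝 v, ρ (f x) = ρ (g x)) : f =ᶠ[𝓝 v] g := by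
  filter_upwards [hf.eventually (by rwa [hf0]), hg.eventually (by rwa [hg0]), h] with x h1 h2 h3
  exact hρ h1 h2 h3

theorem tendsto_prodMk_zero_right : Tendsto (fun t : ℝ => (t, (0 : B))) (𝓝 0) (𝓝 0) :=
  (Continuous.prodMk_left (0 : B)).tendsto' 0 0 rfl

theorem tendsto_prodMk_zero_left : Tendsto (fun b : B => ((0 : ℝ), b)) (𝓝 0) (𝓝 0) :=
  (Continuous.prodMk_right (0 : ℝ)).tendsto' 0 0 rfl

variable [AddCommGroup T] {K : ℝ × B → B}

theorem scaling_lift_zero_right [Module ℝ T]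
    (hN : N ∈ 𝓝 (0 : B)) (hρ : InjOn ρ N) (hρ0 : ρ 0 = 0) (hKc : ContinuousAt K 0) (hK0 : K 0 = 0)
    (hKρ : ∀ᶠ x in 𝓝 (0 : ℝ × B), ρ (K x) = x.1 • ρ x.2) : ∀ᶠ t in 𝓝 (0 : ℝ), K (t, 0) = 0 := by
  have ht0 := tendsto_prodMk_zero_right (B := B)
  refine eventually_eq_of_injOn hN hρ (f := fun t => K (t, 0)) (g := fun _ => 0)
    (ContinuousAt.comp (f := fun t : ℝ => (t, (0 : B))) hKc ht0) continuousAt_const hK0 rfl ?_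
  filter_upwards [ht0.eventually hKρ] with t ht
  rw [ht]; simp [hρ0]

theorem scaling_lift_zero_left [Module ℝ T]
    (hN : N ∈ 𝓝 (0 : B)) (hρ : InjOn ρ N) (hρ0 : ρ 0 = 0) (hKc : ContinuousAt K 0) (hK0 : K 0 = 0)
    (hKρ : ∀ᶠ x in 𝓝 (0 : ℝ × B), ρ (K x) = x.1 • ρ x.2) : ∀ᶠ b in 𝓝 (0 : B), K (0, b) = 0 := by
  have hb0 := tendsto_prodMk_zero_left (B := B)
  refine eventually_eq_of_injOn hN hρ (f := fun b => K (0, b)) (g := fun _ => 0)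
    (ContinuousAt.comp (f := fun b : B => ((0 : ℝ), b)) hKc hb0) continuousAt_const hK0 rfl ?_
  filter_upwards [hb0.eventually hKρ] with t ht
  rw [ht]; simp [hρ0]

variable [NormedSpace ℝ B]

/-- A lift `a` of addition restricts to the identity on both coordinate axes, so that its derivative
on the diagonal is `2 • id`. -/
theorem hasFDerivAt_double {a : B × B → B} (hN : N ∈ 𝓝 (0 : B)) (hρ : InjOn ρ N) (hρ0 : ρ 0 = 0)
    (ha : DifferentiableAt ℝ a 0) (ha0 : a 0 = 0)
    (haρ : ∀ᶠ x in 𝓝 (0 : B × B), ρ (a x) = ρ x.1 + ρ x.2) :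
    HasFDerivAt (fun b => a (b, b)) ((2 : ℝ) • ContinuousLinearMap.id ℝ B) 0 := by
  have key : ∀ ℓ : B →L[ℝ] B × B, (∀ b, ρ (ℓ b).1 + ρ (ℓ b).2 = ρ b) →
      (fderiv ℝ a 0).comp ℓ = ContinuousLinearMap.id ℝ B := by
    intro ℓ hℓ
    have hℓ0 : Tendsto ℓ (𝓝 0) (𝓝 0) := by simpa using ℓ.continuous.tendsto 0
    have h1 : (fun b => a (ℓ b)) =ᶠ[𝓝 0] id := by
      refine eventually_eq_of_injOn hN hρ ?_ continuousAt_id (by simpa using ha0) rfl ?_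
      · refine ContinuousAt.comp (f := ℓ) ?_ ℓ.continuous.continuousAt
        simpa using ha.continuousAt
      · filter_upwards [hℓ0.eventually haρ] with b hb
        rw [hb, hℓ, id]
    have h2 : HasFDerivAt (fun b => a (ℓ b)) ((fderiv ℝ a 0).comp ℓ) 0 := by
      refine HasFDerivAt.comp (f := ℓ) 0 ?_ ℓ.hasFDerivAt
      simpa using ha.hasFDerivAt
    exact (h2.congr_of_eventuallyEq h1.symm).unique (hasFDerivAt_id 0)
  have e1 := key (.inl ℝ B B) fun b => by simp [hρ0]
  have e2 := key (.inr ℝ B B) fun b => by simp [hρ0]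
  have h : HasFDerivAt (fun b => a (b, b)) ((fderiv ℝ a 0).comp
      ((ContinuousLinearMap.id ℝ B).prod (ContinuousLinearMap.id ℝ B))) 0 :=
    HasFDerivAt.comp (f := fun b : B => (b, b)) 0 (by exact ha.hasFDerivAt)
      ((hasFDerivAt_id (𝕜 := ℝ) (0 : B)).prodMk (hasFDerivAt_id 0))
  refine h.congr_fderiv ?_
  ext b
  have e1b := congrArg (· b) e1
  have e2b := congrArg (· b) e2
  simp only [ContinuousLinearMap.comp_apply, ContinuousLinearMap.inl_apply,
    ContinuousLinearMap.inr_apply, ContinuousLinearMap.id_apply] at e1b e2b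
  have : ((b, b) : B × B) = (b, 0) + (0, b) := by simp
  simp only [ContinuousLinearMap.comp_apply, ContinuousLinearMap.prod_apply,
    ContinuousLinearMap.id_apply, _root_.smul_apply]
  rw [this, map_add, e1b, e2b, two_smul]

variable [Module ℝ T]

theorem iterate_double {D : B → B} (hD0 : D 0 = 0)
    (hD : HasFDerivAt D ((2 : ℝ) • ContinuousLinearMap.id ℝ B) 0)
    (hDρ : ∀ᶠ b in 𝓝 (0 : B), ρ (D b) = (2 : ℝ) • ρ b) (j : ℕ) :
    D^[j] 0 = 0 ∧ HasFDerivAt D^[j] ((2 : ℝ) ^ j • ContinuousLinearMap.id ℝ B) 0 ∧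
      ∀ᶠ b in 𝓝 (0 : B), ρ (D^[j] b) = (2 : ℝ) ^ j • ρ b := by
  induction j with
  | zero => exact ⟨rfl, by simpa using hasFDerivAt_id (𝕜 := ℝ) (0 : B), by simp⟩
  | succ j ih =>
    obtain ⟨h1, h2, h3⟩ := ih
    rw [Function.iterate_succ']
    refine ⟨by simp [h1, hD0], ?_, ?_⟩
    · have h4 : HasFDerivAt (D ∘ D^[j]) _ 0 := HasFDerivAt.comp (f := D^[j]) 0 (by rwa [h1]) h2
      refine h4.congr_fderiv ?_
      ext b
      simp [pow_succ, smul_smul]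
    · have h4 := h2.continuousAt.tendsto
      rw [h1] at h4
      filter_upwards [h3, h4.eventually hDρ] with b hb hb'
      rw [Function.comp_apply, hb', hb, smul_smul, pow_succ']

/-- The lift `K` of scaling satisfies `∂_t ∂_b K(0, 0) = id`: the map `K(2 ^ (-j), ·)` is inverted
by the `j`-th iterate of the lift of doubling, so that its derivative is `2 ^ (-j) • id`. -/
theorem scaling_lift_mixed_deriv
    (hN : N ∈ 𝓝 (0 : B)) (hρ : InjOn ρ N) (hρ0 : ρ 0 = 0) (hK : ContDiffAt ℝ 2 K 0) (hK0 : K 0 = 0)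
    (hKρ : ∀ᶠ x in 𝓝 (0 : ℝ × B), ρ (K x) = x.1 • ρ x.2)
    {a : B × B → B} (ha : DifferentiableAt ℝ a 0) (ha0 : a 0 = 0)
    (haρ : ∀ᶠ x in 𝓝 (0 : B × B), ρ (a x) = ρ x.1 + ρ x.2) (w : B) :
    fderiv ℝ (fderiv ℝ K) 0 (1, 0) (0, w) = w := by
  have hfK : HasFDerivAt (fderiv ℝ K) (fderiv ℝ (fderiv ℝ K) 0) 0 :=
    ((hK.fderiv_right (m := 1) (by norm_num)).differentiableAt (by simp)).hasFDerivAt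
  have hKd : ∀ᶠ x in 𝓝 (0 : ℝ × B), DifferentiableAt ℝ K x :=
    (hK.eventually (by simp)).mono fun x hx => hx.differentiableAt (by simp)
  have ht0 := tendsto_prodMk_zero_right (B := B)
  have hb0 := tendsto_prodMk_zero_left (B := B)
  have hKt0 := scaling_lift_zero_right hN hρ hρ0 hK.continuousAt hK0 hKρ
  have hK0b := scaling_lift_zero_left hN hρ hρ0 hK.continuousAt hK0 hKρ
  have hA0 : ∀ w : B, fderiv ℝ K 0 (0, w) = 0 := by
    intro w
    have h1 : HasFDerivAt (fun b : B => K (0, b)) ((fderiv ℝ K 0).comp (.inr ℝ ℝ B)) 0 :=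
      HasFDerivAt.comp (f := ContinuousLinearMap.inr ℝ ℝ B) 0
        (by exact hKd.self_of_nhds.hasFDerivAt) (ContinuousLinearMap.hasFDerivAt _)
    have h2 := (h1.congr_of_eventuallyEq
      (EventuallyEq.symm (hK0b : (fun b => K (0, b)) =ᶠ[𝓝 0] fun _ => 0))).unique
      (hasFDerivAt_const (0 : B) 0)
    simpa using congrArg (· w) h2
  have hhalf : Tendsto (fun j : ℕ => ((1 / 2 : ℝ)) ^ j) atTop (𝓝 0) :=
    tendsto_pow_atTop_nhds_zero_of_lt_one (by norm_num) (by norm_num)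
  have hA : ∀ᶠ j : ℕ in atTop, ∀ w : B,
      fderiv ℝ K ((1 / 2 : ℝ) ^ j, 0) (0, w) = (1 / 2 : ℝ) ^ j • w := by
    have hD := hasFDerivAt_double hN hρ hρ0 ha ha0 haρ
    have hdiag : Tendsto (fun b : B => (b, b)) (𝓝 0) (𝓝 0) :=
      (continuous_id.prodMk continuous_id).tendsto' 0 0 rfl
    have hDρ : ∀ᶠ b in 𝓝 (0 : B), ρ (a (b, b)) = (2 : ℝ) • ρ b := by
      filter_upwards [hdiag.eventually haρ] with b hb
      rw [hb, two_smul]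
    filter_upwards [hhalf.eventually hKt0, hhalf.eventually (ht0.eventually hKd),
      hhalf.eventually (ht0.eventually (eventually_eventually_nhds.2 hKρ))] with j h1 h2 h3 w
    obtain ⟨h4, h5, h6⟩ := iterate_double (D := fun b => a (b, b)) ha0 hD hDρ j
    have hi : Tendsto (fun b : B => ((1 / 2 : ℝ) ^ j, b)) (𝓝 0) (𝓝 ((1 / 2 : ℝ) ^ j, 0)) :=
      (Continuous.prodMk_right ((1 / 2 : ℝ) ^ j)).tendsto 0
    have hKj : ContinuousAt (fun b : B => K ((1 / 2 : ℝ) ^ j, b)) 0 :=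
      ContinuousAt.comp (f := fun b : B => ((1 / 2 : ℝ) ^ j, b)) h2.continuousAt hi
    have hKj0 : Tendsto (fun b : B => K ((1 / 2 : ℝ) ^ j, b)) (𝓝 0) (𝓝 0) := by
      have := hKj.tendsto
      rwa [h1] at this
    have hcomp : HasFDerivAt (fun b : B => K ((1 / 2 : ℝ) ^ j, b))
        ((fderiv ℝ K ((1 / 2 : ℝ) ^ j, 0)).comp (.inr ℝ ℝ B)) 0 :=
      HasFDerivAt.comp (f := fun b : B => ((1 / 2 : ℝ) ^ j, b)) 0 h2.hasFDerivAt
        (hasFDerivAt_prodMk_right _ _)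
    have h7 := HasFDerivAt.comp (f := fun b : B => K ((1 / 2 : ℝ) ^ j, b))
      (g := (fun b => a (b, b))^[j]) 0 (by rwa [h1]) hcomp
    have h8 : (fun b => a (b, b))^[j] ∘ (fun b : B => K ((1 / 2 : ℝ) ^ j, b)) =ᶠ[𝓝 0] id := by
      refine eventually_eq_of_injOn hN hρ h7.continuousAt continuousAt_id ?_ rfl ?_
      · rw [Function.comp_apply, h1, h4]
      · filter_upwards [hi.eventually h3, hKj0.eventually h6] with b hb hb'
        rw [Function.comp_apply, hb', hb, smul_smul, ← mul_pow]
        norm_num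
    have h9 := congrArg (· w) ((h7.congr_of_eventuallyEq h8.symm).unique (hasFDerivAt_id 0))
    simp only [ContinuousLinearMap.comp_apply, _root_.smul_apply,
      ContinuousLinearMap.id_apply, ContinuousLinearMap.inr_apply] at h9
    rw [← h9, smul_smul, ← mul_pow, h9]
    norm_num
  have h1 : HasDerivAt (fun t : ℝ => fderiv ℝ K (t, 0) (0, w))
      (fderiv ℝ (fderiv ℝ K) 0 (1, 0) (0, w)) 0 := by
    have hi : HasDerivAt (fun t : ℝ => (t, (0 : B))) (1, 0) 0 :=
      (hasDerivAt_id 0).prodMk (hasDerivAt_const _ _)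
    exact (HasFDerivAt.comp_hasDerivAt (f := fun t : ℝ => (t, (0 : B))) 0 hfK hi).clm_apply
      (hasDerivAt_const _ _) |>.congr_deriv (by simp)
  have h2 : Tendsto (fun j : ℕ => ((1 / 2 : ℝ)) ^ j) atTop (𝓝[≠] 0) :=
    tendsto_nhdsWithin_iff.2 ⟨hhalf, Eventually.of_forall fun j => by simp⟩
  have h3 := (hasDerivAt_iff_tendsto_slope.1 h1).comp h2
  refine tendsto_nhds_unique h3 (tendsto_const_nhds.congr' ?_)
  filter_upwards [hA] with j hj
  have hz : fderiv ℝ K ((0 : ℝ), (0 : B)) (0, w) = 0 := hA0 w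
  rw [Function.comp_apply, slope_def_module, hj, hz, sub_zero, sub_zero, smul_smul,
    inv_mul_cancel₀ (by positivity), one_smul]

/-- The derivatives `∂_t K(0, b)` of the lift `K` of scaling lie in the range of the derivative of
the lift `γ` of a linear surjection `L`, because `K(t, b) = γ(t • τ)` for small `t` if
`L τ = ρ b`. Hence so does the mixed derivative. -/
theorem scaling_lift_mixed_deriv_mem_range [FiniteDimensional ℝ B]
    {G : Type*} [NormedAddCommGroup G] [NormedSpace ℝ G]
    (hN : N ∈ 𝓝 (0 : B)) (hρ : InjOn ρ N) (hρ0 : ρ 0 = 0) (hK : ContDiffAt ℝ 2 K 0) (hK0 : K 0 = 0)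
    (hKρ : ∀ᶠ x in 𝓝 (0 : ℝ × B), ρ (K x) = x.1 • ρ x.2)
    {γ : G → B} (hγ : DifferentiableAt ℝ γ 0) (hγ0 : γ 0 = 0)
    {L : G →ₗ[ℝ] T} (hL : Function.Surjective L) (hγρ : ∀ᶠ τ in 𝓝 (0 : G), ρ (γ τ) = L τ) (w : B) :
    fderiv ℝ (fderiv ℝ K) 0 (0, w) (1, 0) ∈ LinearMap.range (fderiv ℝ γ 0 : G →ₗ[ℝ] B) := by
  have hfK : HasFDerivAt (fderiv ℝ K) (fderiv ℝ (fderiv ℝ K) 0) 0 :=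
    ((hK.fderiv_right (m := 1) (by norm_num)).differentiableAt (by simp)).hasFDerivAt
  have hKd : ∀ᶠ x in 𝓝 (0 : ℝ × B), DifferentiableAt ℝ K x :=
    (hK.eventually (by simp)).mono fun x hx => hx.differentiableAt (by simp)
  have hb0 := tendsto_prodMk_zero_left (B := B)
  have hK0b := scaling_lift_zero_left hN hρ hρ0 hK.continuousAt hK0 hKρ
  set R : Submodule ℝ B := LinearMap.range (fderiv ℝ γ 0 : G →ₗ[ℝ] B) with hR
  have hRc : IsClosed (R : Set B) := R.closed_of_finiteDimensional
  have hKR : ∀ᶠ b in 𝓝 (0 : B), fderiv ℝ K (0, b) (1, 0) ∈ R := by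
    filter_upwards [hK0b, hb0.eventually (eventually_eventually_nhds.2 hKρ),
      hb0.eventually hKd] with b h1 h2 h3
    obtain ⟨τ, hτ⟩ := hL (ρ b)
    have hi : HasDerivAt (fun t : ℝ => (t, b)) (1, 0) 0 :=
      (hasDerivAt_id 0).prodMk (hasDerivAt_const _ _)
    have h4 : HasDerivAt (fun t : ℝ => K (t, b)) (fderiv ℝ K (0, b) (1, 0)) 0 :=
      HasFDerivAt.comp_hasDerivAt (f := fun t : ℝ => (t, b)) 0 h3.hasFDerivAt hi
    have hj : HasDerivAt (fun t : ℝ => t • τ) τ 0 := by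
      simpa using (hasDerivAt_id (0 : ℝ)).smul_const τ
    have h5 : HasDerivAt (fun t : ℝ => γ (t • τ)) (fderiv ℝ γ 0 τ) 0 :=
      HasFDerivAt.comp_hasDerivAt (f := fun t : ℝ => t • τ) 0
        (by simpa using hγ.hasFDerivAt) hj
    have hj0 : Tendsto (fun t : ℝ => t • τ) (𝓝 0) (𝓝 0) := by
      have := hj.continuousAt.tendsto
      rwa [zero_smul] at this
    have h6 : (fun t : ℝ => K (t, b)) =ᶠ[𝓝 0] fun t : ℝ => γ (t • τ) := by
      refine eventually_eq_of_injOn hN hρ h4.continuousAt h5.continuousAt h1 (by simp [hγ0]) ?_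
      filter_upwards [hi.continuousAt.eventually h2, hj0.eventually hγρ] with t ht ht'
      rw [ht, ht', map_smul, hτ]
    rw [(h4.congr_of_eventuallyEq h6.symm).unique h5]
    exact ⟨τ, rfl⟩
  have hi : HasDerivAt (fun s : ℝ => ((0 : ℝ), s • w)) (0, w) 0 := by
    simpa using (hasDerivAt_const (0 : ℝ) (0 : ℝ)).prodMk
      ((hasDerivAt_id (0 : ℝ)).smul_const w)
  have hz : ((0 : ℝ), (0 : ℝ) • w) = 0 := by rw [zero_smul]; rfl
  have hfK' : HasFDerivAt (fderiv ℝ K) (fderiv ℝ (fderiv ℝ K) 0) ((0 : ℝ), (0 : ℝ) • w) := by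
    rw [hz]; exact hfK
  have h0 : HasDerivAt (fun s : ℝ => fderiv ℝ K (0, s • w)) (fderiv ℝ (fderiv ℝ K) 0 (0, w)) 0 :=
    HasFDerivAt.comp_hasDerivAt (f := fun s : ℝ => ((0 : ℝ), s • w)) 0 hfK' hi
  have h1 := h0.clm_apply (hasDerivAt_const (0 : ℝ) ((1 : ℝ), (0 : B)))
  rw [map_zero, add_zero] at h1
  refine hRc.mem_of_tendsto (hasDerivAt_iff_tendsto_slope.1 h1) ?_
  have hw : Tendsto (fun s : ℝ => s • w) (𝓝 0) (𝓝 0) :=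
    (continuous_id.smul continuous_const).tendsto' 0 0 (by simp)
  filter_upwards [nhdsWithin_le_nhds (hw.eventually hKR)] with s hs
  rw [slope_def_module]
  refine R.smul_mem _ (R.sub_mem hs ?_)
  simpa using hKR.self_of_nhds

/-- Let `ρ` parametrize a neighbourhood of zero of the vector space `T` injectively, in such a way
that scaling, addition and the linear surjection `L` lift to smooth maps through `ρ`. Then the lift
`γ` of `L` is a submersion at zero. Indeed, the lift `K` of scaling satisfies `∂_b K(t, 0) = t • id`
for `t = 2 ^ (-j)`, since `K(2 ^ (-j), ·)` is inverted by the `j`-th iterate of doubling, whose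
derivative is known. On the other hand `∂_t K(0, b)` lies in the range of `γ'(0)`, since scaling
factors through `γ` near zero. Symmetry of the second derivative of `K` compares the two. -/
theorem surjective_fderiv_of_linear_lift [FiniteDimensional ℝ B]
    {G : Type*} [NormedAddCommGroup G] [NormedSpace ℝ G] [FiniteDimensional ℝ G]
    (hN : N ∈ 𝓝 (0 : B)) (hρ : InjOn ρ N) (hρ0 : ρ 0 = 0)
    (hK : ContDiffAt ℝ ∞ K 0) (hK0 : K 0 = 0)
    (hKρ : ∀ᶠ x in 𝓝 (0 : ℝ × B), ρ (K x) = x.1 • ρ x.2)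
    {a : B × B → B} (ha : ContDiffAt ℝ ∞ a 0) (ha0 : a 0 = 0)
    (haρ : ∀ᶠ x in 𝓝 (0 : B × B), ρ (a x) = ρ x.1 + ρ x.2)
    {γ : G → B} (hγ : ContDiffAt ℝ ∞ γ 0) (hγ0 : γ 0 = 0)
    {L : G →ₗ[ℝ] T} (hL : Function.Surjective L) (hγρ : ∀ᶠ τ in 𝓝 (0 : G), ρ (γ τ) = L τ) :
    Function.Surjective (fderiv ℝ γ 0) := by
  have hK2 : ContDiffAt ℝ 2 K 0 := hK.of_le (by norm_cast)
  intro w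
  have hw := scaling_lift_mixed_deriv_mem_range hN hρ hρ0 hK2 hK0 hKρ
    (hγ.differentiableAt (by simp)) hγ0 hL hγρ w
  rw [← (hK2.isSymmSndFDerivAt (by simp)).eq (1, 0) (0, w), scaling_lift_mixed_deriv hN hρ hρ0 hK2
    hK0 hKρ (ha.differentiableAt (by simp)) ha0 haρ] at hw
  exact hw

end VectorSpaceChart

/-! ### Inverse functions with smoothness on neighbourhoods -/

section InverseFunction

variable {V : Type*} [NormedAddCommGroup V] [NormedSpace ℝ V]
  {W : Type*} [NormedAddCommGroup W] [NormedSpace ℝ W]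

/-- The inverse function theorem. -/
theorem ContDiffNear.exists_inverse [FiniteDimensional ℝ V] {f : V → W} {v : V}
    (hf : ContDiffNear f v) (e : V ≃L[ℝ] W)
    (he : HasFDerivAt f (e : V →L[ℝ] W) v) :
    ∃ h : W → V, ContDiffNear h (f v) ∧ h (f v) = v ∧ (∀ᶠ w in 𝓝 (f v), f (h w) = w) ∧
      ∀ᶠ x in 𝓝 v, h (f x) = x := by
  have : CompleteSpace V := FiniteDimensional.complete ℝ V
  have hfs := hf.contDiffAt.hasStrictFDerivAt' he (by simp)
  let Ψ := hfs.toOpenPartialHomeomorph f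
  have hv : v ∈ Ψ.source := hfs.mem_toOpenPartialHomeomorph_source
  have hΨ : ∀ x, Ψ x = f x := fun x => rfl
  have hfv : f v ∈ Ψ.target := Ψ.map_source hv
  have hsymm : Ψ.symm (f v) = v := Ψ.left_inv hv
  refine ⟨Ψ.symm, ?_, hsymm, ?_, ?_⟩
  · have h1 : ∀ᶠ x in 𝓝 v,
        ContDiffAt ℝ ∞ f x ∧ ∃ e' : V ≃L[ℝ] W, (e' : V →L[ℝ] W) = fderiv ℝ f x := by
      refine hf.and ?_
      have hc : ContinuousAt (fderiv ℝ f) v :=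
        (hf.contDiffAt.fderiv_right (m := 0) (by simp)).continuousAt
      refine hc.eventually (p := fun A => ∃ e' : V ≃L[ℝ] W, (e' : V →L[ℝ] W) = A) ?_
      rw [he.fderiv]
      exact ContinuousLinearEquiv.nhds e
    have hcs : Tendsto Ψ.symm (𝓝 (f v)) (𝓝 v) := by
      have := Ψ.symm.continuousAt hfv
      rwa [ContinuousAt, hsymm] at this
    filter_upwards [hcs.eventually h1, Ψ.open_target.mem_nhds hfv] with w ⟨h2, e', he'⟩ hw
    exact Ψ.contDiffAt_symm hw (f₀' := e')
      (by rw [he']; exact (h2.differentiableAt (by simp)).hasFDerivAt) h2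
  · filter_upwards [Ψ.open_target.mem_nhds hfv] with w hw using Ψ.right_inv hw
  · filter_upwards [Ψ.open_source.mem_nhds hv] with x hx using Ψ.left_inv hx

/-- A submersion has a smooth local right inverse. -/
theorem ContDiffNear.exists_rightInverse [FiniteDimensional ℝ W] {f : V → W} {v : V}
    (hf : ContDiffNear f v)
    (hs : Function.Surjective (fderiv ℝ f v)) :
    ∃ h : W → V, ContDiffNear h (f v) ∧ h (f v) = v ∧ ∀ᶠ w in 𝓝 (f v), f (h w) = w := by
  obtain ⟨L, hL⟩ := (fderiv ℝ f v : V →ₗ[ℝ] W).exists_rightInverse_of_surjective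
    (LinearMap.range_eq_top.2 hs)
  let L' : W →L[ℝ] V := LinearMap.toContinuousLinearMap L
  have hι : ∀ x : W, HasFDerivAt (fun w => v + L' w) L' x := fun x => L'.hasFDerivAt.const_add v
  have hιs : ContDiff ℝ ∞ (fun w => v + L' w) := contDiff_const.add L'.contDiff
  have h0 : v + L' 0 = v := by simp
  have hd : HasFDerivAt (fun w => f (v + L' w)) ((fderiv ℝ f v).comp L') 0 :=
    HasFDerivAt.comp (f := fun w => v + L' w) 0
      (by rw [h0]; exact (hf.contDiffAt.differentiableAt (by simp)).hasFDerivAt) (hι 0)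
  have hd' : HasFDerivAt (fun w => f (v + L' w))
      (ContinuousLinearEquiv.refl ℝ W : W →L[ℝ] W) 0 := by
    refine hd.congr_fderiv ?_
    ext w
    exact congrArg (· w) hL
  have hn : ContDiffNear (fun w => f (v + L' w)) 0 :=
    ContDiffNear.comp (φ := fun w => v + L' w) (by rwa [h0]) (hιs.contDiffNear 0)
  obtain ⟨h, h1, h2, h3, -⟩ := hn.exists_inverse _ hd'
  rw [h0] at h1 h2 h3
  refine ⟨fun w => v + L' (h w), ?_, by simp [h2], h3⟩
  exact (hιs.contDiffNear _).comp h1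

/-- The implicit function theorem: near `v`, the fiber of a submersion `f` through `v` is
parametrized by the kernel of the derivative. The coordinates `β` on the fiber extend a projection
onto that kernel affinely to the whole space. -/
theorem ContDiffNear.exists_fiber_parametrization [FiniteDimensional ℝ V] [FiniteDimensional ℝ W]
    {f : V → W} {v : V} (hf : ContDiffNear f v)
    (hs : Function.Surjective (fderiv ℝ f v)) :
    ∃ (φ : LinearMap.ker (fderiv ℝ f v : V →ₗ[ℝ] W) → V)
      (β : V → LinearMap.ker (fderiv ℝ f v : V →ₗ[ℝ] W)),
      ContDiffNear φ 0 ∧ ContDiff ℝ ∞ β ∧ φ 0 = v ∧ β v = 0 ∧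
      (∀ᶠ b in 𝓝 0, f (φ b) = f v ∧ β (φ b) = b) ∧ (∀ᶠ x in 𝓝 v, f x = f v → φ (β x) = x) ∧
      ∀ w (x : LinearMap.ker (fderiv ℝ f v : V →ₗ[ℝ] W)), w = (x : V) → fderiv ℝ β v w = x := by
  set D := fderiv ℝ f v with hD
  set B := LinearMap.ker (D : V →ₗ[ℝ] W)
  obtain ⟨pr, hpr⟩ := B.subtype.exists_leftInverse_of_injective (by simp)
  let pr' : V →L[ℝ] B := LinearMap.toContinuousLinearMap pr
  have hpr' : ∀ b : B, pr' b = b := fun b => congrArg (· b) hpr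
  let β : V → B := fun x => pr' (x - v)
  have hβd : HasFDerivAt β pr' v := pr'.hasFDerivAt.comp v ((hasFDerivAt_id v).sub_const v)
  have hβs : ContDiff ℝ ∞ β := pr'.contDiff.comp (contDiff_id.sub contDiff_const)
  have hβ0 : β v = 0 := by simp [β]
  have hDd : HasFDerivAt f D v := (hf.contDiffAt.differentiableAt (by simp)).hasFDerivAt
  let e₀ : V ≃ₗ[ℝ] W × B := LinearEquiv.ofBijective
    ((D.prod pr' : V →L[ℝ] W × B) : V →ₗ[ℝ] W × B) (by
    constructor
    · rw [← LinearMap.ker_eq_bot, LinearMap.ker_eq_bot']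
      intro x hx
      have hx1 : D x = 0 := congrArg Prod.fst hx
      have hx2 : pr' x = 0 := congrArg Prod.snd hx
      have := hpr' ⟨x, hx1⟩
      rw [hx2] at this
      exact (congrArg Subtype.val this).symm
    · rintro ⟨w, b⟩
      obtain ⟨x, hx⟩ := hs w
      have hk : ∀ y : B, D y = 0 := fun y => y.2
      refine ⟨x - pr' x + b, Prod.ext ?_ ?_⟩
      · change D (x - pr' x + b) = w
        simp [hk, hx]
      · change pr' (x - pr' x + b) = b
        simp [hpr'])
  let e := e₀.toContinuousLinearEquiv
  have he : HasFDerivAt (fun x => (f x, β x)) (e : V →L[ℝ] W × B) v :=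
    (hDd.prodMk hβd).congr_fderiv (by ext x <;> rfl)
  obtain ⟨h, h1, h2, h3, h4⟩ :=
    (hf.prodMk (hβs.contDiffNear v)).exists_inverse e he
  rw [hβ0] at h1 h2 h3
  have hi : Tendsto (fun b : B => (f v, b)) (𝓝 0) (𝓝 (f v, 0)) :=
    (Continuous.prodMk_right (f v)).tendsto 0
  refine ⟨fun b => h (f v, b), β, ?_, hβs, h2, hβ0, ?_, ?_, ?_⟩
  · exact ContDiffNear.comp (φ := fun b : B => (f v, b)) h1
      ((contDiff_const.prodMk contDiff_id).contDiffNear 0)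
  · filter_upwards [hi.eventually h3] with b hb
    exact ⟨congrArg Prod.fst hb, congrArg Prod.snd hb⟩
  · filter_upwards [h4] with x hx hfx
    rwa [hfx] at hx
  · rintro w x rfl
    rw [hβd.fderiv, hpr']

end InverseFunction

/-! ### Germs of plots and sections of a bundle of vector spaces -/

section BundleGerms

variable {X : Type u} {dX : DiffeologicalSpace X} {E : VectorSpaceBundle.{u, v} X dX}
  {V : Type*} [NormedAddCommGroup V] [NormedSpace ℝ V]

theorem isPlotAt_smul [FiniteDimensional ℝ V] {f : V → E.Total} {c : V → ℝ} {w : V}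
    (hf : IsPlotAt f w) (hc : ContDiffNear c w) :
    IsPlotAt (fun x => (⟨(f x).1, c x • (f x).2⟩ : E.Total)) w :=
  E.smooth_smul.comp_isPlotAt (f := fun x => (c x, f x))
    (isPlotAt_prod_iff.2 ⟨isPlotAt_iff_contDiffNear.2 hc, hf⟩)

theorem isPlotAt_add {y : V → X} {a b : ∀ x, E.fiber (y x)} {w : V}
    (ha : IsPlotAt (fun x => (⟨y x, a x⟩ : E.Total)) w)
    (hb : IsPlotAt (fun x => (⟨y x, b x⟩ : E.Total)) w) :
    IsPlotAt (fun x => (⟨y x, a x + b x⟩ : E.Total)) w := by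
  let : DiffeologicalSpace (Σ x, E.fiber x × E.fiber x) :=
    inducedDiffeology (fun e => ((⟨e.1, e.2.1⟩, ⟨e.1, e.2.2⟩) : E.Total × E.Total))
  have h : IsPlotAt (fun x => (⟨y x, a x, b x⟩ : Σ x, E.fiber x × E.fiber x)) w :=
    isPlotAt_induced_iff.2 (isPlotAt_prod_iff.2 ⟨ha, hb⟩)
  exact DSmooth.comp_isPlotAt (F := fun e : Σ x, E.fiber x × E.fiber x =>
    (⟨e.1, e.2.1 + e.2.2⟩ : E.Total)) E.smooth_add h

theorem isPlotAt_zero {y : V → X} {w : V} (hy : IsPlotAt y w) :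
    IsPlotAt (fun x => (⟨y x, 0⟩ : E.Total)) w :=
  E.smooth_zero.comp_isPlotAt hy

theorem isPlotAt_sum {ι : Type*} {y : V → X} {a : ι → ∀ x, E.fiber (y x)} {w : V} (s : Finset ι)
    (hy : IsPlotAt y w) (ha : ∀ i ∈ s, IsPlotAt (fun x => (⟨y x, a i x⟩ : E.Total)) w) :
    IsPlotAt (fun x => (⟨y x, ∑ i ∈ s, a i x⟩ : E.Total)) w := by
  classical
  induction s using Finset.induction_on with
  | empty => simpa using isPlotAt_zero hy
  | insert i s hi ih =>
    simp only [Finset.sum_insert hi]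
    exact isPlotAt_add (ha i (Finset.mem_insert_self i s))
      (ih fun j hj => ha j (Finset.mem_insert_of_mem hj))

theorem total_snd_eq {e : E.Total} {x : X} {s : ∀ x, E.fiber x} (h : e = ⟨x, s x⟩) :
    e.2 = s e.1 := by
  subst h; rfl

open Classical in
/-- The vector `e`, if it lies in the fiber over `x`, and zero otherwise. -/
def fiberValue (x : X) (e : E.Total) : E.fiber x := if h : e.1 = x then h ▸ e.2 else 0

theorem fiberValue_mk (x : X) (e : E.fiber x) : fiberValue x (⟨x, e⟩ : E.Total) = e := by
  simp [fiberValue]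

theorem mk_fiberValue {x : X} {e : E.Total} (h : e.1 = x) :
    (⟨x, fiberValue x e⟩ : E.Total) = e := by
  subst h; rw [fiberValue_mk e.1 e.2]

theorem mk_zero_congr {x y : X} (h : x = y) : (⟨x, 0⟩ : E.Total) = ⟨y, 0⟩ := by
  subst h; rfl

end BundleGerms

section Sections

variable {d : ℕ} {M : Type u} [TopologicalSpace M] [ChartedSpace (EuclideanSpace ℝ (Fin d)) M]
  {E : BundleOver.{u, v} d M} {V : Type*} [NormedAddCommGroup V] [NormedSpace ℝ V]
  [FiniteDimensional ℝ V]

theorem contMDiffAt_fst_of_isPlotAt {f : V → E.Total} {w : V} (hf : IsPlotAt f w) :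
    ∀ᶠ x in 𝓝 w, ContMDiffAt 𝓘(ℝ, V) (𝓡 d) ∞ (fun x => (f x).1) x :=
  isPlotAt_manifold_iff.1 (@DSmooth.comp_isPlotAt V _ _ _ _ M (manifoldDiffeology d M) _
    E.smooth_proj f w hf)

/-- The section `s` is smooth near `m`, tested on smooth maps through `m`. -/
def IsSmoothSectionAt (E : BundleOver.{u, v} d M) (s : ∀ m, E.fiber m) (m : M) : Prop :=
  ∀ (n : ℕ) (p : EuclideanSpace ℝ (Fin n) → M) (r : EuclideanSpace ℝ (Fin n)), p r = m →
    (∀ᶠ t in 𝓝 r, ContMDiffAt (𝓡 n) (𝓡 d) ∞ p t) →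
      IsPlotAt (fun t => (⟨p t, s (p t)⟩ : E.Total)) r

theorem IsSmoothSection.isPlotAt {s : ∀ m, E.fiber m} (hs : IsSmoothSection E s) {p : V → M} {w : V}
    (hp : ∀ᶠ x in 𝓝 w, ContMDiffAt 𝓘(ℝ, V) (𝓡 d) ∞ p x) :
    IsPlotAt (fun x => (⟨p x, s (p x)⟩ : E.Total)) w :=
  @DSmooth.comp_isPlotAt V _ _ M (manifoldDiffeology d M) _ _ _ hs p w
    (isPlotAt_manifold_iff.2 hp)

theorem isSmoothSection_of_isSmoothSectionAt {s : ∀ m, E.fiber m}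
    (h : ∀ m, IsSmoothSectionAt E s m) : IsSmoothSection E s := by
  intro n p hp
  refine isPlot_of_isPlotAt fun r => h _ n p r rfl (Eventually.of_forall fun t => ?_)
  exact (show ContMDiff (𝓡 n) (𝓡 d) ∞ p from hp).contMDiffAt

theorem IsSmoothSection.isSmoothSectionAt {s : ∀ m, E.fiber m} (hs : IsSmoothSection E s) (m : M) :
    IsSmoothSectionAt E s m :=
  fun _ _ _ _ hp => hs.isPlotAt hp

theorem IsSmoothSectionAt.congr {s t : ∀ m, E.fiber m} {m : M} (hs : IsSmoothSectionAt E s m)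
    (h : ∀ᶠ y in 𝓝 m, t y = s y) : IsSmoothSectionAt E t m := by
  intro n p r hr hp
  subst hr
  refine (hs n p r rfl hp).congr ?_
  filter_upwards [hp.self_of_nhds.continuousAt.eventually h] with x hx
  rw [hx]

theorem IsSmoothSectionAt.smul (f : C^∞⟮𝓡 d, M; ℝ⟯) {s : ∀ m, E.fiber m} {m : M}
    (hs : IsSmoothSectionAt E s m) : IsSmoothSectionAt E (fun y => f y • s y) m := by
  intro n p r hr hp
  refine isPlotAt_smul (c := fun x => f (p x)) (hs n p r hr hp) ?_
  filter_upwards [hp] with x hx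
  exact (f.contMDiff.contMDiffAt.comp x hx).contDiffAt

/-- Cutting off a section that is smooth on a neighbourhood of the support of `χ`. -/
theorem isSmoothSection_cutoff (χ : C^∞⟮𝓡 d, M; ℝ⟯) {s : ∀ m, E.fiber m}
    (hs : ∀ m ∈ tsupport χ, IsSmoothSectionAt E s m) :
    IsSmoothSection E (fun m => χ m • s m) := by
  refine isSmoothSection_of_isSmoothSectionAt fun m => ?_
  by_cases hm : m ∈ tsupport χ
  · exact (hs m hm).smul χ
  · refine ((SmoothSection.isSmoothSection_zero (E := E)).isSmoothSectionAt m).congr ?_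
    filter_upwards [notMem_tsupport_iff_eventuallyEq.1 hm] with y hy
    rw [hy]; simp

variable [IsManifold (𝓡 d) ∞ M]

theorem contMDiffAt_chart_symm_of_mem_target {m : M} {x : EuclideanSpace ℝ (Fin d)}
    (hx : x ∈ (chartAt (EuclideanSpace ℝ (Fin d)) m).target) :
    ContMDiffAt (𝓡 d) (𝓡 d) ∞ (chartAt (EuclideanSpace ℝ (Fin d)) m).symm x :=
  contMDiffOn_chart_symm.contMDiffAt
    ((chartAt (EuclideanSpace ℝ (Fin d)) m).open_target.mem_nhds hx)

theorem eventually_chart_symm {m : M} :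
    ∀ᶠ x in 𝓝 (chartAt (EuclideanSpace ℝ (Fin d)) m m),
      x ∈ (chartAt (EuclideanSpace ℝ (Fin d)) m).target ∧
      ContMDiffAt (𝓡 d) (𝓡 d) ∞ (chartAt (EuclideanSpace ℝ (Fin d)) m).symm x := by
  filter_upwards [(chartAt (EuclideanSpace ℝ (Fin d)) m).open_target.mem_nhds
    ((chartAt (EuclideanSpace ℝ (Fin d)) m).map_source (mem_chart_source _ m))] with x hx
  exact ⟨hx, contMDiffAt_chart_symm_of_mem_target hx⟩

variable [T2Space M]

/-- A bump function at `m` with support in a given neighbourhood. -/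
theorem exists_cutoff {m : M} {O : Set M} (hO : O ∈ 𝓝 m) :
    ∃ χ : C^∞⟮𝓡 d, M; ℝ⟯, tsupport χ ⊆ O ∧ ∀ᶠ y in 𝓝 m, χ y = 1 := by
  obtain ⟨f, -, hf⟩ := (SmoothBumpFunction.nhds_basis_tsupport (I := 𝓡 d) m).mem_iff.1 hO
  exact ⟨⟨f, f.contMDiff⟩, hf, f.eventuallyEq_one⟩

/-- Every vector of a VB-tepui is a value of a smooth section: a lift of the inverse of a chart of
`M`, cut off. -/
theorem exists_section_through (hE : IsVBTepui E) {m : M} (e : E.fiber m) :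
    ∃ σ : SmoothSection E, σ.1 m = e := by
  classical
  let := manifoldDiffeology d M
  have hπ : IsPlotwiseSubmersion E.proj := (show IsTepuiFibration E.proj from hE).1.1
  let κ := chartAt (EuclideanSpace ℝ (Fin d)) m
  have hm : m ∈ κ.source := mem_chart_source _ m
  have hx : ∀ᶠ x in 𝓝 (κ m), ContMDiffAt (𝓡 d) (𝓡 d) ∞ κ.symm x :=
    eventually_chart_symm.mono fun x hx => hx.2
  obtain ⟨q, hq, hqm, hqπ⟩ := hπ.exists_lift (f := κ.symm) (v := κ m)
    (isPlotAt_manifold_iff.2 hx) (x := ⟨m, e⟩) (κ.left_inv hm)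
  let s : ∀ y, E.fiber y := fun y => fiberValue y (q (κ y))
  have hs1 : ∀ y, (q (κ y)).1 = y → (⟨y, s y⟩ : E.Total) = q (κ y) := fun y hy => mk_fiberValue hy
  have hκm : ContinuousAt κ m := κ.continuousAt hm
  have hgood : ∀ᶠ y in 𝓝 m, y ∈ κ.source ∧ IsPlotAt q (κ y) ∧ ∀ᶠ z in 𝓝 y, (q (κ z)).1 = z := by
    have h1 : ∀ᶠ z in 𝓝 m, (q (κ z)).1 = z := by
      filter_upwards [hκm.eventually hqπ, κ.open_source.mem_nhds hm] with z hz hz'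
      rw [← κ.left_inv hz']
      simpa [VectorSpaceBundle.proj, κ.left_inv hz'] using hz
    filter_upwards [κ.open_source.mem_nhds hm, hκm.eventually hq.eventually,
      eventually_eventually_nhds.2 h1] with y h2 h3 h4 using ⟨h2, h3, h4⟩
  obtain ⟨χ, hχ, hχ1⟩ := exists_cutoff (d := d) hgood
  refine ⟨⟨_, isSmoothSection_cutoff χ (s := s) fun y hy => ?_⟩, ?_⟩
  · obtain ⟨h2, h3, h4⟩ := hχ hy
    intro n p r hr hp
    subst hr
    have h5 : ContDiffNear (fun t => κ (p t)) r := by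
      filter_upwards [hp, hp.self_of_nhds.continuousAt.eventually
        (κ.open_source.mem_nhds h2)] with t ht ht'
      exact ((contMDiffOn_chart.contMDiffAt (κ.open_source.mem_nhds ht')).comp t ht).contDiffAt
    refine (IsPlotAt.comp_of_eq (f := q) h3 h5 rfl).congr ?_
    filter_upwards [hp.self_of_nhds.continuousAt.eventually h4] with t ht
    exact hs1 _ ht
  · have h1 := hs1 m (by rw [hqm])
    rw [hqm] at h1
    simp only [hχ1.self_of_nhds, one_smul]
    exact eq_of_heq (Sigma.mk.inj h1).2

end Sections

/-! ### Minimal charts at zero vectors -/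

section LocalGenerators

variable {d : ℕ} {M : Type u} [TopologicalSpace M] [ChartedSpace (EuclideanSpace ℝ (Fin d)) M]
  {E : BundleOver.{u, v} d M}

/-- A minimal chart at the zero vector over `m`, extended by a constant to a map `P` on the whole of
`ℝⁿ`, together with the properties of it that do not mention its domain: `G` stands for the set of
points of the domain, and plots of `E` lift through `P` at those points. -/
structure ZeroChart (E : BundleOver.{u, v} d M) (m : M) where
  n : ℕ
  G : Set (EuclideanSpace ℝ (Fin n))
  P : EuclideanSpace ℝ (Fin n) → E.Total
  pt : EuclideanSpace ℝ (Fin n)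
  isOpen : IsOpen G
  mem : pt ∈ G
  apply_pt : P pt = ⟨m, 0⟩
  isPlotAt : ∀ u ∈ G, IsPlotAt P u
  lift : ∀ (V : Type) [NormedAddCommGroup V] [NormedSpace ℝ V] [FiniteDimensional ℝ V]
    (f : V → E.Total) (v : V), IsPlotAt f v → ∀ u ∈ G, f v = P u →
      ∃ q : V → EuclideanSpace ℝ (Fin n), ContDiffNear q v ∧ q v = u ∧ ∀ᶠ w in 𝓝 v, P (q w) = f w
  injOn : InjOn P {u | u ∈ G ∧ (P u).1 = m}

theorem exists_zeroChart (hE : IsVBTepui E) (m : M) : Nonempty (ZeroChart E m) := by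
  classical
  let := manifoldDiffeology d M
  have hT : IsTepuiFibration E.proj := hE
  obtain ⟨n, U, p, hp, ⟨u, hu⟩, hps, hinj⟩ := hT.exists_minimalChart ⟨m, 0⟩
  let P : EuclideanSpace ℝ (Fin n) → E.Total := fun t => if h : t ∈ U then p ⟨t, h⟩ else ⟨m, 0⟩
  have hP : ∀ t : U, P t = p t := fun t => by simp [P]
  refine ⟨⟨n, U, P, u, U.2, u.2, (hP u).trans hu, fun t ht => isPlotAt_of_dSmooth_opens hp hP ht,
    fun V _ _ _ f v hf t ht hft => ?_, ?_⟩⟩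
  · obtain ⟨q, hq, hqv, hqf⟩ := hps.exists_lift hf (x := ⟨t, ht⟩) (hft.trans (hP ⟨t, ht⟩))
    refine ⟨fun w => q w, isPlotAt_opens_iff.1 hq, congrArg Subtype.val hqv, ?_⟩
    filter_upwards [hqf] with w hw
    rw [hP, hw]
  · rintro t ⟨ht, htm⟩ t' ⟨ht', htm'⟩ h
    have e1 := hP ⟨t, ht⟩
    have e2 := hP ⟨t', ht'⟩
    have := @hinj ⟨t, ht⟩ (by change (p _).1 = m; rw [← e1]; exact htm) ⟨t', ht'⟩
      (by change (p _).1 = m; rw [← e2]; exact htm') (by rw [← e1, ← e2]; exact h)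
    exact congrArg Subtype.val this

namespace ZeroChart

variable {m : M} (C : ZeroChart E m)

/-- The projection of `E` in the coordinates given by `C` and by the preferred chart at `m`. -/
def base (u : EuclideanSpace ℝ (Fin C.n)) : EuclideanSpace ℝ (Fin d) :=
  chartAt (EuclideanSpace ℝ (Fin d)) m (C.P u).1

theorem contMDiffAt_fst : ∀ᶠ u in 𝓝 C.pt, ContMDiffAt (𝓡 C.n) (𝓡 d) ∞ (fun u => (C.P u).1) u :=
  contMDiffAt_fst_of_isPlotAt (C.isPlotAt _ C.mem)

theorem fst_pt : (C.P C.pt).1 = m := by rw [C.apply_pt]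

theorem eventually_mem_source : ∀ᶠ u in 𝓝 C.pt,
    (C.P u).1 ∈ (chartAt (EuclideanSpace ℝ (Fin d)) m).source := by
  have h := C.contMDiffAt_fst.self_of_nhds.continuousAt
  refine h.eventually ((chartAt (EuclideanSpace ℝ (Fin d)) m).open_source.mem_nhds ?_)
  change (C.P C.pt).1 ∈ _
  rw [C.fst_pt]
  exact mem_chart_source _ m

theorem base_pt : C.base C.pt = chartAt (EuclideanSpace ℝ (Fin d)) m m := by
  rw [base, C.fst_pt]

variable [IsManifold (𝓡 d) ∞ M]

theorem contDiffNear_base : ContDiffNear C.base C.pt := by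
  filter_upwards [C.contMDiffAt_fst, C.eventually_mem_source] with u h1 h2
  exact ((contMDiffOn_chart.contMDiffAt ((chartAt (EuclideanSpace ℝ (Fin d)) m).open_source.mem_nhds
    h2)).comp u h1).contDiffAt

/-- The base coordinates are a submersion, because the zero section lifts to the chart. -/
theorem surjective_fderiv_base : Function.Surjective (fderiv ℝ C.base C.pt) := by
  let κ := chartAt (EuclideanSpace ℝ (Fin d)) m
  have h1 : IsPlotAt (fun x => (⟨κ.symm x, 0⟩ : E.Total)) (κ m) :=
    (SmoothSection.isSmoothSection_zero (E := E)).isPlotAt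
      (eventually_chart_symm.mono fun x hx => hx.2)
  obtain ⟨ζ, hζ, hζ0, hζP⟩ := C.lift _ _ _ h1 _ C.mem (by
    rw [C.apply_pt]
    exact mk_zero_congr (κ.left_inv (mem_chart_source _ m)))
  have h2 : (fun x => C.base (ζ x)) =ᶠ[𝓝 (κ m)] id := by
    filter_upwards [hζP, eventually_chart_symm (m := m)] with x hx hx'
    rw [base, hx]
    exact κ.right_inv hx'.1
  have h3 : HasFDerivAt (fun x => C.base (ζ x))
      ((fderiv ℝ C.base C.pt).comp (fderiv ℝ ζ (κ m))) (κ m) :=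
    HasFDerivAt.comp (g := C.base) (f := ζ) (κ m)
      (by rw [hζ0]; exact (C.contDiffNear_base.contDiffAt.differentiableAt (by simp)).hasFDerivAt)
      (hζ.contDiffAt.differentiableAt (by simp)).hasFDerivAt
  have h4 := (h3.congr_of_eventuallyEq h2.symm).unique (hasFDerivAt_id (κ m))
  exact fun w => ⟨fderiv ℝ ζ (κ m) w, congrArg (· w) h4⟩

/-- For sections `σ i` that span the fiber `E_m`, a lift `g` to the chart `C` of the map
`(x, τ) ↦ ∑ τ i • σ i x` is a submersion. In the direction of `x` this holds because `g` is a map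
over `M`; in the direction of the fiber, parametrized by `ρ`, it is
`surjective_fderiv_of_linear_lift`, applied to lifts of scaling, addition and
`τ ↦ ∑ τ i • σ i m`. -/
theorem surjective_fderiv_of_lift {ι : Type} [Fintype ι]
    {σ : ι → SmoothSection E} (hσ : ⊤ ≤ Submodule.span ℝ (range fun i => (σ i).1 m))
    {g : EuclideanSpace ℝ (Fin d) × (ι → ℝ) → EuclideanSpace ℝ (Fin C.n)}
    (hg : ContDiffNear g (chartAt (EuclideanSpace ℝ (Fin d)) m m, 0))
    (hg0 : g (chartAt (EuclideanSpace ℝ (Fin d)) m m, 0) = C.pt)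
    (hgP : ∀ᶠ z in 𝓝 (chartAt (EuclideanSpace ℝ (Fin d)) m m, (0 : ι → ℝ)),
      C.P (g z) = ⟨(chartAt (EuclideanSpace ℝ (Fin d)) m).symm z.1,
        ∑ i, z.2 i • (σ i).1 ((chartAt (EuclideanSpace ℝ (Fin d)) m).symm z.1)⟩) :
    Function.Surjective (fderiv ℝ g (chartAt (EuclideanSpace ℝ (Fin d)) m m, 0)) := by
  let κ := chartAt (EuclideanSpace ℝ (Fin d)) m
  have hκm : κ.symm (κ m) = m := κ.left_inv (mem_chart_source _ m)
  have hfib := C.contDiffNear_base.exists_fiber_parametrization C.surjective_fderiv_base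
  have hbd : HasFDerivAt C.base (fderiv ℝ C.base C.pt) C.pt :=
    (C.contDiffNear_base.contDiffAt.differentiableAt (by simp)).hasFDerivAt
  set D := fderiv ℝ C.base C.pt with hD
  set B := LinearMap.ker (D : EuclideanSpace ℝ (Fin C.n) →ₗ[ℝ] EuclideanSpace ℝ (Fin d))
  obtain ⟨φ, β, hφ, hβ, hφ0, hβ0, hφβ, hβφ, hβd⟩ := hfib
  let ρ : B → E.fiber m := fun b => fiberValue m (C.P (φ b))
  have hφc : Tendsto φ (𝓝 0) (𝓝 C.pt) := by
    have := hφ.continuousAt.tendsto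
    rwa [hφ0] at this
  -- Points of the chart over `m`.
  have hover : ∀ᶠ b in 𝓝 (0 : B), φ b ∈ C.G ∧ (C.P (φ b)).1 = m ∧ β (φ b) = b := by
    filter_upwards [hφc.eventually (C.isOpen.mem_nhds C.mem),
      hφc.eventually C.eventually_mem_source, hφβ] with b h1 h2 h3
    refine ⟨h1, ?_, h3.2⟩
    refine κ.injOn h2 (mem_chart_source _ m) ?_
    have := h3.1
    rwa [C.base_pt] at this
  have hρP : ∀ᶠ b in 𝓝 (0 : B), C.P (φ b) = ⟨m, ρ b⟩ := by
    filter_upwards [hover] with b hb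
    exact (mk_fiberValue hb.2.1).symm
  have hρ0 : ρ 0 = 0 := by
    simp only [ρ, hφ0, C.apply_pt, fiberValue_mk]
  have hρinj : InjOn ρ {b | φ b ∈ C.G ∧ (C.P (φ b)).1 = m ∧ β (φ b) = b} := by
    rintro b ⟨h1, h2, h3⟩ b' ⟨h1', h2', h3'⟩ h
    have : C.P (φ b) = C.P (φ b') := by
      rw [← mk_fiberValue h2, ← mk_fiberValue h2']
      exact congrArg _ h
    rw [← h3, ← h3', C.injOn ⟨h1, h2⟩ ⟨h1', h2'⟩ this]
  have hρplot : IsPlotAt (fun b => (⟨m, ρ b⟩ : E.Total)) 0 := by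
    refine IsPlotAt.congr ?_ (hρP.mono fun b hb => hb.symm)
    exact IsPlotAt.comp_of_eq (C.isPlotAt _ C.mem) hφ hφ0
  -- Lifts of maps into the fiber `E_m` to the parameter space `B`.
  have hcoord : ∀ {V : Type} [NormedAddCommGroup V] [NormedSpace ℝ V] (f : V → E.fiber m) (v : V)
      (q : V → EuclideanSpace ℝ (Fin C.n)), ContDiffNear q v → q v = C.pt →
      (∀ᶠ w in 𝓝 v, C.P (q w) = ⟨m, f w⟩) →
      ContDiffAt ℝ ∞ (fun w => β (q w)) v ∧ β (q v) = 0 ∧ ∀ᶠ w in 𝓝 v, ρ (β (q w)) = f w := by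
    intro V _ _ f v q hq hqv hqf
    refine ⟨(hβ.contDiffAt).comp v hq.contDiffAt, by rw [hqv, hβ0], ?_⟩
    have hqt : Tendsto q (𝓝 v) (𝓝 C.pt) := by
      have := hq.continuousAt.tendsto
      rwa [hqv] at this
    filter_upwards [hqf, hqt.eventually hβφ] with w h1 h2
    have h3 : φ (β (q w)) = q w := h2 (by rw [C.base_pt, base, h1])
    simp only [ρ, h3, h1, fiberValue_mk]
  have hlift : ∀ {V : Type} [NormedAddCommGroup V] [NormedSpace ℝ V] [FiniteDimensional ℝ V]
      (f : V → E.fiber m) (v : V), IsPlotAt (fun w => (⟨m, f w⟩ : E.Total)) v → f v = 0 →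
      ∃ q : V → B, ContDiffAt ℝ ∞ q v ∧ q v = 0 ∧ ∀ᶠ w in 𝓝 v, ρ (q w) = f w := by
    intro V _ _ _ f v hf hfv
    obtain ⟨q, hq, hqv, hqf⟩ := C.lift V _ v hf C.pt C.mem (by rw [hfv, C.apply_pt])
    exact ⟨fun w => β (q w), hcoord f v q hq hqv hqf⟩
  obtain ⟨K, hK, hK0, hKρ⟩ := hlift (fun x : ℝ × B => x.1 • ρ x.2) 0
    (isPlotAt_smul (c := fun x : ℝ × B => x.1) (f := fun x : ℝ × B => ⟨m, ρ x.2⟩)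
      (hρplot.comp_of_eq (contDiff_snd.contDiffNear (0 : ℝ × B)) rfl)
      (contDiff_fst.contDiffNear _)) (by simp)
  obtain ⟨a, ha, ha0, haρ⟩ := hlift (fun x : B × B => ρ x.1 + ρ x.2) 0
    (isPlotAt_add (E := E) (y := fun _ : B × B => m)
      (hρplot.comp_of_eq (contDiff_fst.contDiffNear (0 : B × B)) rfl)
      (hρplot.comp_of_eq (contDiff_snd.contDiffNear (0 : B × B)) rfl)) (by simp [hρ0])
  let L : (ι → ℝ) →ₗ[ℝ] E.fiber m := Fintype.linearCombination ℝ fun i => (σ i).1 m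
  have hL : Function.Surjective L := by
    rw [← LinearMap.range_eq_top, Fintype.range_linearCombination]
    exact top_le_iff.1 hσ
  have hi : ContDiff ℝ ∞ (fun τ : ι → ℝ => (κ m, τ)) := contDiff_const.prodMk contDiff_id
  obtain ⟨hγ, hγ0, hγρ⟩ := hcoord (fun τ : ι → ℝ => L τ) 0 (fun τ => g (κ m, τ))
    (hg.comp (φ := fun τ : ι → ℝ => (κ m, τ)) (hi.contDiffNear 0)) hg0 (by
      filter_upwards [(hi.continuous.tendsto 0).eventually hgP] with τ hτ
      rw [hτ]
      simp only [L, Fintype.linearCombination_apply]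
      have : ∀ y : M, y = m → (⟨y, ∑ i, τ i • (σ i).1 y⟩ : E.Total) =
        ⟨m, ∑ i, τ i • (σ i).1 m⟩ := by rintro y rfl; rfl
      exact this _ hκm)
  have hsurj := surjective_fderiv_of_linear_lift hover hρinj hρ0 hK hK0 hKρ ha ha0 haρ hγ hγ0 hL hγρ
  -- The derivative of `g`.
  have hgd : HasFDerivAt g (fderiv ℝ g (κ m, 0)) (κ m, 0) :=
    (hg.contDiffAt.differentiableAt (by simp)).hasFDerivAt
  set g' := fderiv ℝ g (κ m, 0)
  have hbase : ∀ y : EuclideanSpace ℝ (Fin d) × (ι → ℝ), D (g' y) = y.1 := by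
    have h1 : (fun z => C.base (g z)) =ᶠ[𝓝 (κ m, (0 : ι → ℝ))] Prod.fst := by
      filter_upwards [hgP, (continuous_fst.tendsto (κ m, (0 : ι → ℝ))).eventually
        (eventually_chart_symm (m := m))] with z hz hz'
      rw [base, hz]
      exact κ.right_inv hz'.1
    have h2 : HasFDerivAt (fun z => C.base (g z)) (D.comp g') (κ m, (0 : ι → ℝ)) :=
      HasFDerivAt.comp (g := C.base) (f := g) _ (by rw [hg0]; exact hbd) hgd
    have h3 := (h2.congr_of_eventuallyEq h1.symm).unique hasFDerivAt_fst
    exact fun y => congrArg (· y) h3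
  have hγd : ∀ τ, fderiv ℝ (fun τ : ι → ℝ => β (g (κ m, τ))) 0 τ = fderiv ℝ β C.pt (g' (0, τ)) := by
    have h1 : HasFDerivAt (fun τ : ι → ℝ => g (κ m, τ))
        (g'.comp (.inr ℝ (EuclideanSpace ℝ (Fin d)) (ι → ℝ))) 0 :=
      HasFDerivAt.comp (f := fun τ : ι → ℝ => (κ m, τ)) 0 hgd (hasFDerivAt_prodMk_right _ _)
    have h2 : HasFDerivAt (fun τ : ι → ℝ => β (g (κ m, τ)))
        ((fderiv ℝ β C.pt).comp (g'.comp (.inr ℝ (EuclideanSpace ℝ (Fin d)) (ι → ℝ)))) 0 :=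
      HasFDerivAt.comp (f := fun τ : ι → ℝ => g (κ m, τ)) 0
        (by rw [hg0]; exact (hβ.contDiffAt.differentiableAt (by simp)).hasFDerivAt) h1
    intro τ
    rw [h2.fderiv]
    rfl
  intro v
  have hz : D (v - g' (D v, 0)) = 0 := by rw [map_sub, hbase, sub_self]
  obtain ⟨τ, hτ⟩ := hsurj ⟨v - g' (D v, 0), hz⟩
  have hk : D (g' (0, τ)) = 0 := hbase (0, τ)
  rw [hγd, hβd _ ⟨g' (0, τ), hk⟩ rfl] at hτ
  refine ⟨(D v, τ), ?_⟩
  have h5 : g' (0, τ) = v - g' (D v, 0) := congrArg Subtype.val hτ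
  have h6 : ((D v, τ) : EuclideanSpace ℝ (Fin d) × (ι → ℝ)) = (D v, 0) + (0, τ) := by simp
  rw [h6, map_add, h5]
  abel

end ZeroChart

end LocalGenerators

/-! ### Sections generating the plots of a bundle -/

section Generation

variable {d : ℕ} {M : Type u} [TopologicalSpace M] [ChartedSpace (EuclideanSpace ℝ (Fin d)) M]
  {E : BundleOver.{u, v} d M}

/-- The sections `σ i` generate `E` at `m`: each plot of `E` through a vector over `m` is locally a
linear combination of them with smooth coefficients. -/
def GeneratesAt {ι : Type} [Fintype ι] (σ : ι → SmoothSection E) (m : M) : Prop :=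
  ∀ (n : ℕ) (Q : EuclideanSpace ℝ (Fin n) → E.Total) (r : EuclideanSpace ℝ (Fin n)),
    IsPlotAt Q r → (Q r).1 = m → ∃ c : EuclideanSpace ℝ (Fin n) → ι → ℝ,
      ContDiffNear c r ∧ ∀ᶠ t in 𝓝 r, (Q t).2 = ∑ i, c t i • (σ i).1 (Q t).1

/-- Sections of a VB-tepui that span the fiber over `m` linearly generate `E` near `m`. Indeed the
map `(x, τ) ↦ ∑ τ i • σ i x` factors through a minimal chart at the zero vector over `m` by a
submersion, a right inverse of which gives coefficients for all plots close to that zero vector. -/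
theorem eventually_generatesAt [IsManifold (𝓡 d) ∞ M] (hE : IsVBTepui E) {m : M} {ι : Type}
    [Fintype ι] {σ : ι → SmoothSection E}
    (hσ : ⊤ ≤ Submodule.span ℝ (range fun i => (σ i).1 m)) :
    ∀ᶠ y in 𝓝 m, GeneratesAt σ y := by
  obtain ⟨C⟩ := exists_zeroChart hE m
  let κ := chartAt (EuclideanSpace ℝ (Fin d)) m
  have hκm : κ.symm (κ m) = m := κ.left_inv (mem_chart_source _ m)
  let Φ : EuclideanSpace ℝ (Fin d) × (ι → ℝ) → E.Total := fun z =>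
    ⟨κ.symm z.1, ∑ i, z.2 i • (σ i).1 (κ.symm z.1)⟩
  have hsm : ∀ᶠ z in 𝓝 (κ m, (0 : ι → ℝ)),
      ContMDiffAt 𝓘(ℝ, EuclideanSpace ℝ (Fin d) × (ι → ℝ)) (𝓡 d) ∞ (fun z => κ.symm z.1) z := by
    filter_upwards [(continuous_fst.tendsto (κ m, (0 : ι → ℝ))).eventually
      (eventually_chart_symm (m := m))] with z hz
    exact hz.2.comp z contDiff_fst.contMDiff.contMDiffAt
  have hΦ : IsPlotAt Φ (κ m, 0) := by
    refine isPlotAt_sum (E := E) (y := fun z : EuclideanSpace ℝ (Fin d) × (ι → ℝ) => κ.symm z.1)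
      (a := fun i z => z.2 i • (σ i).1 (κ.symm z.1)) Finset.univ
      (isPlotAt_manifold_iff.2 hsm) fun i _ => ?_
    refine isPlotAt_smul (c := fun z : EuclideanSpace ℝ (Fin d) × (ι → ℝ) => z.2 i)
      ((σ i).2.isPlotAt hsm) (ContDiff.contDiffNear ?_ _)
    fun_prop
  have hΦ0 : ∀ x, Φ (x, 0) = ⟨κ.symm x, 0⟩ := fun x => by simp [Φ]
  obtain ⟨g, hg, hg0, hgP⟩ := C.lift _ _ _ hΦ _ C.mem (by
    rw [C.apply_pt, hΦ0]; exact mk_zero_congr hκm)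
  -- `s` inverts `g` from the right, so that the chart `C` factors through `Φ`.
  obtain ⟨s, hs, hs0, hgs⟩ := hg.exists_rightInverse (C.surjective_fderiv_of_lift hσ hg hg0 hgP)
  rw [hg0] at hs hs0 hgs
  have hst : Tendsto s (𝓝 C.pt) (𝓝 (κ m, 0)) := by
    have := hs.continuousAt.tendsto
    rwa [hs0] at this
  have hgt : Tendsto g (𝓝 (κ m, 0)) (𝓝 C.pt) := by
    have := hg.continuousAt.tendsto
    rwa [hg0] at this
  have hPΦ : ∀ᶠ u in 𝓝 C.pt, C.P u = Φ (s u) := by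
    filter_upwards [hgs, hst.eventually hgP] with u h1 h2
    rw [← h2, h1]
  have hu : ∀ᶠ u in 𝓝 C.pt, u ∈ C.G ∧ ContDiffNear s u ∧ ∀ᶠ u' in 𝓝 u, C.P u' = Φ (s u') := by
    filter_upwards [C.isOpen.mem_nhds C.mem, hs.eventually, eventually_eventually_nhds.2 hPΦ]
      with u h1 h2 h3 using ⟨h1, h2, h3⟩
  have hκ : Tendsto (fun y => (κ y, (0 : ι → ℝ))) (𝓝 m) (𝓝 (κ m, 0)) :=
    (κ.continuousAt (mem_chart_source _ m)).prodMk tendsto_const_nhds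
  filter_upwards [κ.open_source.mem_nhds (mem_chart_source _ m), hκ.eventually hgP,
    (hgt.comp hκ).eventually hu] with y hy hPy ⟨hG, hsy, hPΦy⟩
  intro n Q r hQ hQr
  have hf : IsPlotAt (fun x : ℝ × EuclideanSpace ℝ (Fin n) =>
      (⟨(Q x.2).1, x.1 • (Q x.2).2⟩ : E.Total)) (0, r) :=
    isPlotAt_smul (c := fun x : ℝ × EuclideanSpace ℝ (Fin n) => x.1) (f := fun x => Q x.2)
      (IsPlotAt.comp_of_eq (φ := Prod.snd) hQ (contDiff_snd.contDiffNear ((0 : ℝ), r)) rfl)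
      (contDiff_fst.contDiffNear _)
  obtain ⟨q, hq, hq0, hqP⟩ := C.lift _ _ _ hf _ hG (by
    rw [Function.comp_apply, hPy]
    simp only [zero_smul]
    rw [hΦ0]
    exact mk_zero_congr (hQr.trans (κ.left_inv hy).symm))
  have hsq : ContDiffNear (fun x => s (q x)) (0, r) := ContDiffNear.comp (by rwa [hq0]) hq
  have hqt : Tendsto q (𝓝 (0, r)) (𝓝 (g (κ y, 0))) := by
    have := hq.continuousAt.tendsto
    rwa [hq0] at this
  have hfin : ∀ᶠ x in 𝓝 ((0 : ℝ), r), ContDiffNear (fun x => s (q x)) x ∧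
      ∀ᶠ x' in 𝓝 x, (⟨(Q x'.2).1, x'.1 • (Q x'.2).2⟩ : E.Total) = Φ (s (q x')) := by
    refine hsq.eventually.and (eventually_eventually_nhds.2 ?_)
    filter_upwards [hqP, hqt.eventually hPΦy] with x h1 h2
    rw [← h1, h2]
  -- The plot is only small after scaling it down; the scaling is undone in the coefficients.
  have hl : ∀ᶠ l in 𝓝[≠] (0 : ℝ), ContDiffNear (fun x => s (q x)) (l, r) ∧
      ∀ᶠ x' in 𝓝 (l, r), (⟨(Q x'.2).1, x'.1 • (Q x'.2).2⟩ : E.Total) = Φ (s (q x')) :=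
    nhdsWithin_le_nhds (((Continuous.prodMk_left r).tendsto 0).eventually hfin)
  obtain ⟨l, ⟨hl1, hl2⟩, hl0⟩ := (hl.and self_mem_nhdsWithin).exists
  refine ⟨fun t => l⁻¹ • (s (q (l, t))).2, ?_, ?_⟩
  · have h1 : ContDiffNear (fun t => s (q (l, t))) r :=
      ContDiffNear.comp (φ := fun t => (l, t)) hl1
        ((contDiff_const.prodMk contDiff_id).contDiffNear r)
    filter_upwards [h1] with t ht
    exact ht.snd.const_smul l⁻¹
  · filter_upwards [((Continuous.prodMk_right l).tendsto r).eventually hl2] with t ht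
    have h1 := total_snd_eq (s := fun y => ∑ i, (s (q (l, t))).2 i • (σ i).1 y) ht
    simp only at h1
    have h2 : (Q t).2 = l⁻¹ • (l • (Q t).2) := by
      rw [smul_smul, inv_mul_cancel₀ hl0, one_smul]
    rw [h2, h1, Finset.smul_sum]
    simp [smul_smul]

end Generation

/-! ### Coloured covers of manifolds -/

section ColoredCover

open MeasureTheory

/-- The points that lie above the levels `x` of exactly the functions in `J`, apart from those in
`I`, and at which the functions in `I` are at distance less than `1` from their levels and strictly
closer to them than the functions outside `I`. -/
def cell {M ι : Type*} (F : ι → M → ℝ) (x : ι → ℝ) (I J : Finset ι) : Set M :=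
  {y | (∀ i ∈ J, i ∉ I ∧ x i < F i y) ∧ (∀ l ∉ I, l ∉ J → F l y < x l) ∧
    (∀ i ∈ I, |F i y - x i| < 1) ∧ ∀ i ∈ I, ∀ l ∉ I, |F i y - x i| < |F l y - x l|}

/-- Cells for index sets `I` of the same size are disjoint. -/
theorem cell_eq {M ι : Type*} {F : ι → M → ℝ} {x : ι → ℝ} {I J I' J' : Finset ι}
    (hI : I.card = I'.card) {y : M} (hy : y ∈ cell F x I J) (hy' : y ∈ cell F x I' J') :
    I = I' ∧ J = J' := by
  obtain ⟨h1, h2, -, h3⟩ := hy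
  obtain ⟨h1', h2', -, h3'⟩ := hy'
  have hII : I = I' := by
    by_contra hne
    obtain ⟨i, hi, hi'⟩ := Finset.not_subset.1 fun h => hne (Finset.eq_of_subset_of_card_le h hI.ge)
    obtain ⟨l, hl, hl'⟩ := Finset.not_subset.1 fun h =>
      hne (Finset.eq_of_subset_of_card_le h hI.le).symm
    exact lt_asymm (h3 i hi l hl') (h3' l hl i hi')
  subst hII
  refine ⟨rfl, Finset.ext fun i => ⟨fun hi => ?_, fun hi => ?_⟩⟩
  · by_contra h
    exact lt_asymm (h1 i hi).2 (h2' i (h1 i hi).1 h)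
  · by_contra h
    exact lt_asymm (h1' i hi).2 (h2 i (h1' i hi).1 h)

theorem isOpen_cell {M ι : Type*} [TopologicalSpace M] {F : ι → M → ℝ} {x : ι → ℝ}
    (hF : ∀ i, Continuous (F i)) (hx : ∀ i, 0 ≤ x i)
    (hfin : LocallyFinite fun i => {y | F i y ≠ -1}) (I J : Finset ι) :
    IsOpen (cell F x I J) := by
  rw [isOpen_iff_mem_nhds]
  rintro y ⟨h1, h2, h3, h4⟩
  obtain ⟨O, hO, hOfin⟩ := hfin y
  have hc : ∀ i, ContinuousAt (F i) y := fun i => (hF i).continuousAt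
  have hc' : ∀ i, ContinuousAt (fun y => |F i y - x i|) y := fun i => by fun_prop
  have e1 : ∀ᶠ z in 𝓝 y, ∀ i ∈ J, i ∉ I ∧ x i < F i z := by
    refine (Finset.eventually_all J).2 fun i hi => ?_
    filter_upwards [(hc i).eventually (lt_mem_nhds (h1 i hi).2)] with z hz using ⟨(h1 i hi).1, hz⟩
  have e2 : ∀ᶠ z in 𝓝 y, ∀ l ∈ {i | ({y | F i y ≠ -1} ∩ O).Nonempty}, l ∉ I → l ∉ J →
      F l z < x l := by
    refine (eventually_all_finite hOfin).2 fun l _ => ?_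
    by_cases hl : l ∉ I ∧ l ∉ J
    · filter_upwards [(hc l).eventually (gt_mem_nhds (h2 l hl.1 hl.2))] with z hz _ _ using hz
    · exact Eventually.of_forall fun z a b => absurd ⟨a, b⟩ hl
  have e3 : ∀ᶠ z in 𝓝 y, ∀ i ∈ I, |F i z - x i| < 1 :=
    (Finset.eventually_all I).2 fun i hi => (hc' i).eventually (gt_mem_nhds (h3 i hi))
  have e4 : ∀ᶠ z in 𝓝 y, ∀ i ∈ I, ∀ l ∈ {i | ({y | F i y ≠ -1} ∩ O).Nonempty}, l ∉ I →
      |F i z - x i| < |F l z - x l| := by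
    refine (Finset.eventually_all I).2 fun i hi => (eventually_all_finite hOfin).2 fun l _ => ?_
    by_cases hl : l ∉ I
    · filter_upwards [((hc' i).eventually_lt (hc' l) (h4 i hi l hl))] with z hz _ using hz
    · exact Eventually.of_forall fun z a => absurd a hl
  filter_upwards [e1, e2, e3, e4, hO] with z g1 g2 g3 g4 hz
  -- Functions that are `-1` near `y` impose no condition: their levels are nonnegative.
  have hfar : ∀ l, l ∉ {i | ({y | F i y ≠ -1} ∩ O).Nonempty} → F l z = -1 := fun l hl => by
    by_contra h
    exact hl ⟨z, h, hz⟩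
  refine ⟨g1, fun l hl hl' => ?_, g3, fun i hi l hl => ?_⟩
  · by_cases h : l ∈ {i | ({y | F i y ≠ -1} ∩ O).Nonempty}
    · exact g2 l h hl hl'
    · rw [hfar l h]
      linarith [hx l]
  · by_cases h : l ∈ {i | ({y | F i y ≠ -1} ∩ O).Nonempty}
    · exact g4 i hi l h hl
    · refine (g3 i hi).trans_le ?_
      rw [hfar l h, abs_sub_comm]
      refine le_trans ?_ (le_abs_self _)
      linarith [hx l]

variable {d : ℕ} {M : Type u} [TopologicalSpace M] [SecondCountableTopology M]
  [ChartedSpace (EuclideanSpace ℝ (Fin d)) M] [IsManifold (𝓡 d) ∞ M]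

theorem dimH_range_le_of_contMDiff {F : Type*} [NormedAddCommGroup F] [NormedSpace ℝ F] {f : M → F}
    (hf : ContMDiff (𝓡 d) 𝓘(ℝ, F) ∞ f) : dimH (range f) ≤ d := by
  obtain ⟨s, hs, hsU⟩ := _root_.countable_cover_nhds
    (fun m : M => chart_source_mem_nhds (EuclideanSpace ℝ (Fin d)) m)
  have h1 : range f = ⋃ m ∈ s, (f ∘ (chartAt (EuclideanSpace ℝ (Fin d)) m).symm) ''
      (chartAt (EuclideanSpace ℝ (Fin d)) m).target := by
    refine Subset.antisymm ?_ ?_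
    · rintro _ ⟨y, rfl⟩
      obtain ⟨m, hm, hy⟩ : ∃ m ∈ s, y ∈ (chartAt (EuclideanSpace ℝ (Fin d)) m).source := by
        simpa using hsU.ge (mem_univ y)
      refine mem_biUnion hm ⟨_, (chartAt (EuclideanSpace ℝ (Fin d)) m).map_source hy, ?_⟩
      rw [Function.comp_apply, (chartAt (EuclideanSpace ℝ (Fin d)) m).left_inv hy]
    · refine iUnion₂_subset fun m _ => ?_
      rintro _ ⟨x, -, rfl⟩
      exact ⟨_, rfl⟩
  rw [h1, dimH_bUnion hs]
  refine iSup₂_le fun m _ => ?_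
  refine (dimH_image_le_of_locally_lipschitzOn fun x hx => ?_).trans ?_
  · have h2 : ContDiffAt ℝ 1 (f ∘ (chartAt (EuclideanSpace ℝ (Fin d)) m).symm) x :=
      ((hf.contMDiffAt.comp x (contMDiffAt_chart_symm_of_mem_target hx)).contDiffAt).of_le
        (by norm_cast)
    obtain ⟨C, t, ht, hC⟩ := h2.exists_lipschitzOnWith
    exact ⟨C, t, nhdsWithin_le_nhds ht, hC⟩
  · refine (dimH_mono (subset_univ _)).trans ?_
    rw [Real.dimH_univ_eq_finrank]
    simp

/-- Generic levels of countably many smooth functions on a `d`-dimensional manifold: no point lies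
on the level sets of `d + 1` of them. Levels drawn independently from `[0, 1]` have this property
almost surely, because a smooth image of the manifold in `ℝ ^ (d + 1)` is a null set. -/
theorem exists_generic_levels {ι : Type*} [Countable ι] {F : ι → M → ℝ}
    (hF : ∀ i, ContMDiff (𝓡 d) 𝓘(ℝ, ℝ) ∞ (F i)) :
    ∃ x : ι → ℝ, (∀ i, x i ∈ Icc (0 : ℝ) 1) ∧
      ∀ I : Finset ι, I.card = d + 1 → ∀ y, ∃ i ∈ I, F i y ≠ x i := by
  let ν : Measure ℝ := volume.restrict (Icc 0 1)
  have hν : IsProbabilityMeasure ν := ⟨by simp [ν]⟩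
  let P : Measure (ι → ℝ) := Measure.infinitePi fun _ => ν
  have h1 : ∀ᵐ x ∂P, ∀ i, x i ∈ Icc (0 : ℝ) 1 := by
    refine ae_all_iff.2 fun i => ?_
    have h2 : ∀ᵐ t ∂ν, t ∈ Icc (0 : ℝ) 1 := ae_restrict_mem measurableSet_Icc
    rw [← Measure.infinitePi_map_eval (fun _ : ι => ν) i] at h2
    exact ae_of_ae_map (measurable_pi_apply i).aemeasurable h2
  have h2 : ∀ᵐ x ∂P, ∀ I : Finset ι, I.card = d + 1 → ∀ y, ∃ i ∈ I, F i y ≠ x i := by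
    refine ae_all_iff.2 fun I => ?_
    by_cases hI : I.card = d + 1
    swap
    · simp [hI]
    let f : M → (I → ℝ) := fun y i => F i y
    have hf : ContMDiff (𝓡 d) 𝓘(ℝ, I → ℝ) ∞ f := contMDiff_pi_space.2 fun i => hF i
    have h3 : (volume : Measure (I → ℝ)) (range f) = 0 := by
      rw [← hausdorffMeasure_pi_real]
      refine hausdorffMeasure_of_dimH_lt (d := (Fintype.card I : NNReal))
        ((dimH_range_le_of_contMDiff hf).trans_lt ?_)
      rw [Fintype.card_coe, hI]
      norm_cast
      simp
    have h4 : (Measure.pi fun _ : I => ν) (range f) = 0 := by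
      rw [← Measure.restrict_pi_pi]
      exact Measure.restrict_le_self.absolutelyContinuous h3
    have h5 : ∀ᵐ z ∂(Measure.pi fun _ : I => ν), z ∉ range f := measure_eq_zero_iff_ae_notMem.1 h4
    rw [← Measure.infinitePi_map_restrict (fun _ : ι => ν)] at h5
    filter_upwards [ae_of_ae_map (Finset.measurable_restrict I).aemeasurable h5] with x hx _ y
    by_contra! h
    exact hx ⟨y, funext fun i => h i i.2⟩
  obtain ⟨x, hx⟩ := (h1.and h2).exists
  exact ⟨x, hx⟩

/-- Every open cover of a `d`-dimensional manifold has an open refinement that consists of `d + 1`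
families of pairwise disjoint sets. For bump functions that form a locally finite refinement and for
generic levels, the family number `j` consists of neighbourhoods of the strata in which exactly `j`
of the functions attain their level. -/
theorem exists_colored_cover [T2Space M] {U : M → Set M} (hU : ∀ m, U m ∈ 𝓝 m) :
    ∃ (κ : Type u) (N : Fin (d + 1) → κ → Set M), (∀ j k, IsOpen (N j k)) ∧
      (∀ j k k' y, y ∈ N j k → y ∈ N j k' → k = k') ∧ (∀ y, ∃ j k, y ∈ N j k) ∧
      ∀ j k, (N j k).Nonempty → ∃ m, N j k ⊆ U m := by
  classical
  have : LocallyCompactSpace M := ChartedSpace.locallyCompactSpace (EuclideanSpace ℝ (Fin d)) M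
  obtain ⟨ι, f, hf⟩ := SmoothBumpCovering.exists_isSubordinate (𝓡 d) (isClosed_univ (X := M))
    (fun m _ => hU m)
  have hι : Countable ι := countable_univ_iff.1 (f.locallyFinite.countable_univ fun i =>
    ⟨f.c i, by simp [Function.mem_support, SmoothBumpFunction.eq_one]⟩)
  -- The constants are such that `F i` is `-1` off the support of `f i`, below all levels and at
  -- distance at least `1` from them, and `2`, above all levels, where `f i` is `1`.
  let F : ι → M → ℝ := fun i y => 3 * f i y - 1
  have hF : ∀ i, ContMDiff (𝓡 d) 𝓘(ℝ, ℝ) ∞ (F i) := fun i =>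
    (contMDiff_const.mul (f i).contMDiff).sub contMDiff_const
  have hF1 : ∀ i y, F i y ≠ -1 ↔ f i y ≠ 0 := fun i y => by
    simp only [F, ne_eq, not_iff_not]
    constructor <;> intro h <;> linarith
  have hfin : LocallyFinite fun i => {y | F i y ≠ -1} := by
    have : (fun i => {y | F i y ≠ -1}) = fun i => Function.support (f i) := by
      ext i y; exact hF1 i y
    rw [this]
    exact f.locallyFinite
  obtain ⟨x, hx, hxI⟩ := exists_generic_levels hF
  refine ⟨Finset ι × Finset ι, fun j k => {y | k.1.card = j ∧ k.2.Nonempty ∧ y ∈ cell F x k.1 k.2},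
    fun j k => ?_, fun j k k' y hy hy' => ?_, fun y => ?_, fun j k => ?_⟩
  · by_cases h : k.1.card = j ∧ k.2.Nonempty
    · simp only [h, true_and]
      exact isOpen_cell (fun i => (hF i).continuous) (fun i => (hx i).1) hfin _ _
    · convert! isOpen_empty using 1
      ext y
      simp only [mem_ofPred_eq, mem_empty_iff_false, iff_false]
      exact fun hy => h ⟨hy.1, hy.2.1⟩
  · have := cell_eq (hy.1.trans hy'.1.symm) hy.2.2 hy'.2.2
    exact Prod.ext this.1 this.2
  -- The point `y` lies in the cell of the set `I` of functions attaining their level at `y`.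
  · have hyfin : {i | F i y ≠ -1}.Finite := hfin.point_finite y
    have hI : {i | F i y = x i}.Finite := hyfin.subset fun i hi => by
      rw [mem_ofPred_eq] at hi ⊢
      linarith [(hx i).1]
    have hJ : {i | x i < F i y}.Finite := hyfin.subset fun i hi => by
      rw [mem_ofPred_eq] at hi ⊢
      linarith [(hx i).1]
    have hcard : hI.toFinset.card < d + 1 := by
      by_contra! h
      obtain ⟨I, hII, hId⟩ := Finset.exists_subset_card_eq h
      obtain ⟨i, hi, hiy⟩ := hxI I hId y
      exact hiy (hI.mem_toFinset.1 (hII hi))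
    refine ⟨⟨_, hcard⟩, (hI.toFinset, hJ.toFinset), rfl, ⟨f.ind y (mem_univ y), ?_⟩, ?_, ?_, ?_, ?_⟩
    · rw [hJ.mem_toFinset, mem_ofPred_eq]
      simp only [F, f.apply_ind y (mem_univ y)]
      linarith [(hx (f.ind y (mem_univ y))).2]
    · intro i hi
      rw [hJ.mem_toFinset, mem_ofPred_eq] at hi
      exact ⟨fun h => hi.ne' (hI.mem_toFinset.1 h), hi⟩
    · intro l hl hl'
      rw [hI.mem_toFinset] at hl
      rw [hJ.mem_toFinset] at hl'
      exact lt_of_le_of_ne (not_lt.1 hl') hl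
    · intro i hi
      rw [hI.mem_toFinset, mem_ofPred_eq] at hi
      simp [hi]
    · intro i hi l hl
      rw [hI.mem_toFinset, mem_ofPred_eq] at hi hl
      simpa [hi, sub_eq_zero] using hl
  · rintro ⟨_, -, ⟨i, hi⟩, -⟩
    refine ⟨f.c i, fun y hy => hf i (subset_tsupport _ ?_)⟩
    have := (hy.2.2.1 i hi).2
    exact (hF1 i y).1 (by linarith [(hx i).1])

end ColoredCover

/-! ### The module of sections -/

section SectionModule

variable {d : ℕ} {M : Type u} [TopologicalSpace M] [ChartedSpace (EuclideanSpace ℝ (Fin d)) M]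
  {E : BundleOver.{u, v} d M}

/-- Evaluation of sections at a point. -/
def evalAt (E : BundleOver.{u, v} d M) (m : M) : SmoothSection E →+ E.fiber m where
  toFun s := s.1 m
  map_zero' := rfl
  map_add' _ _ := rfl

theorem smul_section_apply (f : C^∞⟮𝓡 d, M; ℝ⟯) (s : SmoothSection E) (m : M) :
    (f • s).1 m = f m • s.1 m := rfl

theorem sum_section_apply {ι : Type*} (t : Finset ι) (s : ι → SmoothSection E) (m : M) :
    (∑ i ∈ t, s i).1 m = ∑ i ∈ t, (s i).1 m :=
  map_sum (evalAt E m) s t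

theorem section_apply_eq_zero_of_mem {m : M} {s : SmoothSection E}
    (hs : s ∈ vanishingIdeal d m • (⊤ : Submodule C^∞⟮𝓡 d, M; ℝ⟯ (SmoothSection E))) :
    s.1 m = 0 := by
  induction hs using Submodule.smul_induction_on' with
  | smul f hf t _ =>
    have : f m = 0 := hf
    rw [smul_section_apply, this, zero_smul]
  | add _ _ _ _ hs ht => exact (congrArg₂ (· + ·) hs ht).trans (add_zero _)

theorem isFiberDetermined_smoothSection (E : BundleOver.{u, v} d M) :
    IsFiberDetermined d M (SmoothSection E) := fun _ hs =>
  Subtype.ext (funext fun m =>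
    section_apply_eq_zero_of_mem ((Submodule.Quotient.mk_eq_zero _).1 (hs m)))

/-- Coefficients of a section with respect to generators, near a point. -/
theorem GeneratesAt.exists_coeff [IsManifold (𝓡 d) ∞ M] {ι : Type} [Fintype ι]
    {σ : ι → SmoothSection E} {m : M} (h : GeneratesAt σ m) (τ : SmoothSection E) :
    ∃ c : M → ι → ℝ, (∀ᶠ y in 𝓝 m, ContMDiffAt (𝓡 d) 𝓘(ℝ, ι → ℝ) ∞ c y) ∧
      ∀ᶠ y in 𝓝 m, τ.1 y = ∑ i, c y i • (σ i).1 y := by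
  let κ := chartAt (EuclideanSpace ℝ (Fin d)) m
  have hm : m ∈ κ.source := mem_chart_source _ m
  obtain ⟨c, hc, hcQ⟩ := h d (fun x => ⟨κ.symm x, τ.1 (κ.symm x)⟩) (κ m)
    (τ.2.isPlotAt (eventually_chart_symm.mono fun x hx => hx.2)) (κ.left_inv hm)
  have hκ : Tendsto κ (𝓝 m) (𝓝 (κ m)) := κ.continuousAt hm
  refine ⟨fun y => c (κ y), ?_, ?_⟩
  · filter_upwards [hκ.eventually hc, κ.open_source.mem_nhds hm] with y hy hy'
    exact hy.contMDiffAt.comp y (contMDiffOn_chart.contMDiffAt (κ.open_source.mem_nhds hy'))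
  · filter_upwards [hκ.eventually hcQ, κ.open_source.mem_nhds hm] with y hy hy'
    change τ.1 (κ.symm (κ y)) = ∑ i, c (κ y) i • (σ i).1 (κ.symm (κ y)) at hy
    rwa [κ.left_inv hy'] at hy

/-- The generators in `g` generate `E` at `m` if some of them are multiples, by a function not
vanishing at `m`, of sections that do. -/
theorem GeneratesAt.of_smul {ι ι' : Type} [Fintype ι] [Fintype ι'] {σ : ι → SmoothSection E}
    {g : ι' → SmoothSection E} {m : M} (h : GeneratesAt σ m) (e : ι → ι') (χ : C^∞⟮𝓡 d, M; ℝ⟯)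
    (hχ : χ m ≠ 0) (hg : ∀ᶠ y in 𝓝 m, ∀ i, (g (e i)).1 y = χ y • (σ i).1 y) : GeneratesAt g m := by
  classical
  intro n Q r hQ hQr
  obtain ⟨c, hc, hcQ⟩ := h n Q r hQ hQr
  have hπ := contMDiffAt_fst_of_isPlotAt hQ
  have hπt : Tendsto (fun t => (Q t).1) (𝓝 r) (𝓝 m) := by
    have := hπ.self_of_nhds.continuousAt.tendsto
    rwa [hQr] at this
  have hχ' : ∀ᶠ y in 𝓝 m, χ y ≠ 0 := χ.contMDiff.continuous.continuousAt.eventually_ne hχ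
  refine ⟨fun t i' => ∑ i, if e i = i' then (χ (Q t).1)⁻¹ * c t i else 0, ?_, ?_⟩
  · filter_upwards [hc, hπ, hπt.eventually hχ'] with t h1 h2 h3
    refine contDiffAt_pi.2 fun i' => ContDiffAt.sum fun i _ => ?_
    split_ifs
    · have h4 : ContDiffAt ℝ ∞ (fun t => χ (Q t).1) t :=
        (χ.contMDiff.contMDiffAt.comp t h2).contDiffAt
      exact (h4.inv h3).mul (contDiffAt_pi.1 h1 i)
    · exact contDiffAt_const
  · filter_upwards [hcQ, hπt.eventually hg, hπt.eventually hχ'] with t h1 h2 h3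
    rw [h1]
    simp only [Finset.sum_smul]
    rw [Finset.sum_comm]
    refine Finset.sum_congr rfl fun i _ => ?_
    simp only [ite_smul, zero_smul, Finset.sum_ite_eq, Finset.mem_univ, if_true]
    rw [h2, smul_smul, mul_right_comm, inv_mul_cancel₀ h3, one_mul]

variable [T2Space M] [IsManifold (𝓡 d) ∞ M]

/-- Sections that generate `E` everywhere generate the module of sections: local coefficients are
glued by a partition of unity, since the possible coefficients at a point form a convex set. -/
theorem exists_eq_sum_of_generatesAt [SecondCountableTopology M] {ι : Type} [Fintype ι]
    {σ : ι → SmoothSection E} (h : ∀ m, GeneratesAt σ m) (τ : SmoothSection E) :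
    ∃ f : ι → C^∞⟮𝓡 d, M; ℝ⟯, τ = ∑ i, f i • σ i := by
  have : LocallyCompactSpace M := ChartedSpace.locallyCompactSpace (EuclideanSpace ℝ (Fin d)) M
  obtain ⟨c, hc⟩ := exists_contMDiffMap_forall_mem_convex_of_local (𝓡 d) (n := ⊤)
    (t := fun y => {c : ι → ℝ | τ.1 y = ∑ i, c i • (σ i).1 y}) (fun y => by
      intro c hc c' hc' a b _ _ hab
      simp only [mem_ofPred_eq] at hc hc' ⊢
      simp only [Pi.add_apply, Pi.smul_apply, smul_eq_mul, add_smul, mul_smul,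
        Finset.sum_add_distrib, ← Finset.smul_sum]
      rw [← hc, ← hc', ← add_smul, hab, one_smul]) (fun m => by
      obtain ⟨c, hc, hcτ⟩ := (h m).exists_coeff τ
      exact ⟨_, hc.and hcτ, c, fun y hy => hy.1.contMDiffWithinAt, fun y hy => hy.2⟩)
  refine ⟨fun i => ⟨fun y => c y i, contMDiff_pi_space.1 c.contMDiff i⟩, Subtype.ext ?_⟩
  funext y
  rw [sum_section_apply]
  exact hc y

/-- Sections through a finite family spanning the fiber over `m`. -/
theorem exists_sections_spanning (hE : IsVBTepui E) {N : ℕ} {m : M}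
    (hN : Module.rank ℝ (E.fiber m) ≤ N) :
    ∃ σ : Fin N → SmoothSection E, ⊤ ≤ Submodule.span ℝ (range fun i => (σ i).1 m) := by
  have : FiniteDimensional ℝ (E.fiber m) :=
    Module.rank_lt_aleph0_iff.1 (hN.trans_lt (Cardinal.natCast_lt_aleph0))
  have hk : Module.finrank ℝ (E.fiber m) ≤ N := Module.finrank_le_of_rank_le hN
  let b := Module.finBasis ℝ (E.fiber m)
  choose σ hσ using fun e : E.fiber m => exists_section_through hE e
  refine ⟨fun i => if h : (i : ℕ) < Module.finrank ℝ (E.fiber m) then σ (b ⟨i, h⟩) else 0, ?_⟩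
  rw [← b.span_eq]
  refine Submodule.span_mono ?_
  rintro _ ⟨j, rfl⟩
  refine ⟨⟨j, j.2.trans_le hk⟩, ?_⟩
  simp [hσ]

/-- A VB-tepui of bounded rank is generated by finitely many sections. For each of the `d + 1`
colours of a coloured cover by sets with at most `N` generators, the generators on the sets of that
colour are combined into `N` sections. -/
theorem exists_generatesAt [SecondCountableTopology M] (hE : IsVBTepui E) {N : ℕ}
    (hN : ∀ m, Module.rank ℝ (E.fiber m) ≤ N) :
    ∃ σ : Fin (d + 1) × Fin N → SmoothSection E, ∀ m, GeneratesAt σ m := by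
  classical
  have : LocallyCompactSpace M := ChartedSpace.locallyCompactSpace (EuclideanSpace ℝ (Fin d)) M
  choose σ hσ using fun m => exists_sections_spanning hE (hN m)
  obtain ⟨κ, O, hOo, hOd, hOc, hOs⟩ := exists_colored_cover (d := d)
    (U := fun m => {y | GeneratesAt (σ m) y}) fun m => eventually_generatesAt hE (hσ m)
  cases isEmpty_or_nonempty M
  · exact ⟨0, fun m => isEmptyElim m⟩
  choose! μ hμ using hOs
  obtain ⟨χ, hχ⟩ := SmoothPartitionOfUnity.exists_isSubordinate (𝓡 d) (isClosed_univ (X := M))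
    (fun j => ⋃ k, O j k) (fun j => isOpen_iUnion (hOo j)) (by
      intro y _
      obtain ⟨j, k, hy⟩ := hOc y
      exact mem_iUnion.2 ⟨j, mem_iUnion.2 ⟨k, hy⟩⟩)
  let s : Fin (d + 1) → Fin N → ∀ y, E.fiber y := fun j a y =>
    if h : ∃ k, y ∈ O j k then (σ (μ j h.choose) a).1 y else 0
  have hs : ∀ j a k, ∀ y ∈ O j k, s j a y = (σ (μ j k) a).1 y := by
    intro j a k y hy
    have h : ∃ k, y ∈ O j k := ⟨k, hy⟩
    simp only [s, dif_pos h]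
    rw [hOd j h.choose k y h.choose_spec hy]
  have hsm : ∀ j a, ∀ y ∈ tsupport (χ j), IsSmoothSectionAt E (s j a) y := by
    intro j a y hy
    obtain ⟨k, hk⟩ := mem_iUnion.1 (hχ j hy)
    refine ((σ (μ j k) a).2.isSmoothSectionAt y).congr ?_
    filter_upwards [(hOo j k).mem_nhds hk] with z hz using hs j a k z hz
  refine ⟨fun i => ⟨_, isSmoothSection_cutoff (χ i.1) (hsm i.1 i.2)⟩, fun m => ?_⟩
  obtain ⟨j, hj⟩ : ∃ j, χ j m ≠ 0 := by
    obtain ⟨j, hj⟩ := χ.exists_pos_of_mem (mem_univ m)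
    exact ⟨j, hj.ne'⟩
  obtain ⟨k, hk⟩ := mem_iUnion.1 (hχ j (subset_tsupport _ hj))
  refine GeneratesAt.of_smul (σ := σ (μ j k)) (hμ j k ⟨m, hk⟩ hk) (fun a => (j, a)) (χ j) hj ?_
  filter_upwards [(hOo j k).mem_nhds hk] with y hy a
  rw [← hs j a k y hy]

theorem finite_smoothSection [SecondCountableTopology M] (hE : IsVBTepui E)
    (hN : E.HasBoundedRank) :
    Module.Finite C^∞⟮𝓡 d, M; ℝ⟯ (SmoothSection E) := by
  classical
  obtain ⟨N, hN⟩ := hN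
  obtain ⟨σ, hσ⟩ := exists_generatesAt hE hN
  refine ⟨⟨Finset.univ.image σ, top_le_iff.1 fun τ _ => ?_⟩⟩
  obtain ⟨f, rfl⟩ := exists_eq_sum_of_generatesAt hσ τ
  exact Submodule.sum_mem _ fun i _ => Submodule.smul_mem _ _ (Submodule.subset_span (by simp))

/-! ### Morphisms and their action on sections -/

/-- A linear map on sections acts pointwise. If `τ` vanishes at `m`, then near `m` it is a
combination of sections through a basis of `E_m` with coefficients vanishing at `m`. -/
theorem apply_eq_zero_of_apply_eq_zero {E' : BundleOver.{u, v} d M} (hE : IsVBTepui E) {m : M}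
    [FiniteDimensional ℝ (E.fiber m)]
    (α : SmoothSection E →ₗ[C^∞⟮𝓡 d, M; ℝ⟯] SmoothSection E') {τ : SmoothSection E}
    (hτ : τ.1 m = 0) : (α τ).1 m = 0 := by
  let b := Module.finBasis ℝ (E.fiber m)
  choose σ hσ using fun i => exists_section_through hE (b i)
  have hspan : ⊤ ≤ Submodule.span ℝ (range fun i => (σ i).1 m) := by
    simp only [hσ]
    exact b.span_eq.ge
  obtain ⟨c, hc, hcτ⟩ := (eventually_generatesAt hE hspan).self_of_nhds.exists_coeff τ
  have hc0 : ∀ i, c m i = 0 := by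
    have h := hcτ.self_of_nhds
    simp only [hτ, hσ] at h
    exact fun i => Fintype.linearIndependent_iff.1 b.linearIndependent (c m) h.symm i
  obtain ⟨χ, hχ, hχ1⟩ := exists_cutoff (d := d) (hc.and hcτ)
  have hsm : ∀ i, ContMDiff (𝓡 d) 𝓘(ℝ, ℝ) ∞ (fun y => χ y * c y i) := by
    refine fun i => contMDiff_of_tsupport fun y hy => ?_
    have hy' : y ∈ tsupport χ := tsupport_mul_subset_left hy
    exact χ.contMDiff.contMDiffAt.mul (contMDiffAt_pi_space.1 (hχ hy').1 i)
  let f : Fin (Module.finrank ℝ (E.fiber m)) → C^∞⟮𝓡 d, M; ℝ⟯ := fun i => ⟨_, hsm i⟩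
  have hf : χ • τ = ∑ i, f i • σ i := by
    refine Subtype.ext (funext fun y => ?_)
    rw [sum_section_apply, smul_section_apply]
    simp only [smul_section_apply]
    change _ = ∑ i, (χ y * c y i) • (σ i).1 y
    by_cases hy : y ∈ tsupport χ
    · rw [(hχ hy).2, Finset.smul_sum]
      simp only [smul_smul]
    · simp [image_eq_zero_of_notMem_tsupport hy]
  have h1 : (α (χ • τ)).1 m = (α τ).1 m := by
    rw [map_smul, smul_section_apply, hχ1.self_of_nhds, one_smul]
  rw [← h1, hf, map_sum, sum_section_apply]
  refine Finset.sum_eq_zero fun i _ => ?_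
  rw [map_smul, smul_section_apply]
  change (χ m * c m i) • _ = _
  rw [hc0, mul_zero, zero_smul]

theorem pushforward_injective {E E' : BundleOver.{u, v} d M} (hE : IsVBTepui E) {f g : E ⟶ E'}
    (h : pushforward f = pushforward g) : f = g := by
  refine VectorSpaceBundle.Hom.ext (funext fun m => LinearMap.ext fun e => ?_)
  obtain ⟨σ, rfl⟩ := exists_section_through hE e
  exact congrFun (congrArg Subtype.val (LinearMap.congr_fun h σ)) m

/-- A linear map `α` on sections is induced by the linear maps `σ m ↦ (α σ) m` on the fibers. They
form a smooth map, because plots are locally combinations of sections. -/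
theorem pushforward_surjective {E E' : BundleOver.{u, v} d M} (hE : IsVBTepui E)
    (hN : E.HasBoundedRank) (α : SmoothSection E →ₗ[C^∞⟮𝓡 d, M; ℝ⟯] SmoothSection E') :
    ∃ f : E ⟶ E', pushforward f = α := by
  obtain ⟨N, hN⟩ := hN
  have hfd : ∀ m, FiniteDimensional ℝ (E.fiber m) := fun m =>
    Module.rank_lt_aleph0_iff.1 ((hN m).trans_lt (Cardinal.natCast_lt_aleph0))
  have hα : ∀ (σ τ : SmoothSection E) (m : M), σ.1 m = τ.1 m → (α σ).1 m = (α τ).1 m := by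
    intro σ τ m h
    have h0 : (σ - τ).1 m = 0 := ((evalAt E m).map_sub σ τ).trans (sub_eq_zero.2 h)
    have h1 := apply_eq_zero_of_apply_eq_zero hE α h0
    rw [map_sub] at h1
    exact sub_eq_zero.1 (((evalAt E' m).map_sub _ _).symm.trans h1)
  choose s hs using fun (m : M) (e : E.fiber m) => exists_section_through hE e
  let f : ∀ m, E.fiber m →ₗ[ℝ] E'.fiber m := fun m =>
    { toFun := fun e => (α (s m e)).1 m
      map_add' := fun e e' => by
        have h : (s m (e + e')).1 m = (s m e + s m e').1 m := by
          change _ = (s m e).1 m + (s m e').1 m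
          simp only [hs]
        rw [hα _ _ m h, map_add]
        rfl
      map_smul' := fun l e => by
        let L : C^∞⟮𝓡 d, M; ℝ⟯ := ⟨fun _ => l, contMDiff_const⟩
        have h : (s m (l • e)).1 m = (L • s m e).1 m := by
          change _ = l • (s m e).1 m
          simp only [hs]
        rw [hα _ _ m h, map_smul]
        rfl }
  have hf : ∀ (σ : SmoothSection E) (m : M), f m (σ.1 m) = (α σ).1 m := fun σ m =>
    hα _ _ m (hs m _)
  refine ⟨⟨f, fun n P hP => isPlot_of_isPlotAt fun r => ?_⟩, LinearMap.ext fun σ =>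
    Subtype.ext (funext fun m => hf σ m)⟩
  obtain ⟨σ, hσ⟩ := exists_sections_spanning hE (hN (P r).1)
  obtain ⟨c, hc, hcP⟩ := (eventually_generatesAt hE hσ).self_of_nhds n P r (hP.isPlotAt r) rfl
  have hπ := contMDiffAt_fst_of_isPlotAt (hP.isPlotAt r)
  refine (isPlotAt_sum (E := E') (y := fun t => (P t).1)
    (a := fun i t => c t i • (α (σ i)).1 (P t).1) Finset.univ
    (isPlotAt_manifold_iff.2 hπ) fun i _ => ?_).congr ?_
  · exact isPlotAt_smul (c := fun t => c t i) (f := fun t => ⟨(P t).1, (α (σ i)).1 (P t).1⟩)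
      ((α (σ i)).2.isPlotAt hπ) (hc.mono fun t ht => contDiffAt_pi.1 ht i)
  · filter_upwards [hcP] with t ht
    simp only [Function.comp_apply, ht, map_sum, map_smul, hf]

end SectionModule

/-! ### The bundle of fibers of a module -/

section FiberAt

variable (d : ℕ) {M : Type u} [TopologicalSpace M] [ChartedSpace (EuclideanSpace ℝ (Fin d)) M]
  (Q : Type v) [AddCommGroup Q] [Module C^∞⟮𝓡 d, M; ℝ⟯ Q]

/-- The fiber `Q / I_m Q` of the module `Q`. -/
def FiberAt (m : M) : Type v :=
  Q ⧸ (vanishingIdeal d m • (⊤ : Submodule C^∞⟮𝓡 d, M; ℝ⟯ Q))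

variable (m : M)

instance : AddCommGroup (FiberAt d Q m) :=
  inferInstanceAs (AddCommGroup (Q ⧸ (vanishingIdeal d m • (⊤ : Submodule C^∞⟮𝓡 d, M; ℝ⟯ Q))))

instance : Module C^∞⟮𝓡 d, M; ℝ⟯ (FiberAt d Q m) :=
  inferInstanceAs (Module C^∞⟮𝓡 d, M; ℝ⟯
    (Q ⧸ (vanishingIdeal d m • (⊤ : Submodule C^∞⟮𝓡 d, M; ℝ⟯ Q))))

/-- Real numbers act on the fibers as constant functions. -/
instance : Module ℝ (FiberAt d Q m) :=
  Module.compHom _ (algebraMap ℝ C^∞⟮𝓡 d, M; ℝ⟯)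

variable {Q}

/-- The class in `Q / I_m Q` of an element of `Q`. -/
def cls : Q →ₗ[C^∞⟮𝓡 d, M; ℝ⟯] FiberAt d Q m :=
  (vanishingIdeal d m • (⊤ : Submodule C^∞⟮𝓡 d, M; ℝ⟯ Q)).mkQ

variable {d m}

theorem cls_surjective : Function.Surjective (cls d m : Q → FiberAt d Q m) :=
  Submodule.mkQ_surjective _

theorem cls_eq_zero_iff {q : Q} :
    cls d m q = 0 ↔ q ∈ vanishingIdeal d m • (⊤ : Submodule C^∞⟮𝓡 d, M; ℝ⟯ Q) :=
  Submodule.Quotient.mk_eq_zero _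

theorem cls_smul (f : C^∞⟮𝓡 d, M; ℝ⟯) (q : Q) : cls d m (f • q) = f m • cls d m q := by
  have h : f m • cls d m q = cls d m (algebraMap ℝ C^∞⟮𝓡 d, M; ℝ⟯ (f m) • q) :=
    ((cls d m).map_smul _ _).symm
  rw [h, ← sub_eq_zero, ← map_sub, ← sub_smul, cls_eq_zero_iff]
  refine Submodule.smul_mem_smul ?_ trivial
  change (f - algebraMap ℝ C^∞⟮𝓡 d, M; ℝ⟯ (f m)) m = 0
  exact sub_self (f m)

theorem cls_sum {ι : Type*} [Fintype ι] (f : ι → C^∞⟮𝓡 d, M; ℝ⟯) (b : ι → Q) :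
    cls d m (∑ i, f i • b i) = ∑ i, f i m • cls d m (b i) := by
  rw [map_sum]
  exact Finset.sum_congr rfl fun i _ => cls_smul _ _

theorem span_range_cls {ι : Type*} {s : ι → Q}
    (hs : Submodule.span C^∞⟮𝓡 d, M; ℝ⟯ (range s) = ⊤) :
    Submodule.span ℝ (range fun i => cls d m (s i)) = ⊤ := by
  refine top_le_iff.1 fun e _ => ?_
  obtain ⟨q, rfl⟩ := cls_surjective e
  have hq : q ∈ Submodule.span C^∞⟮𝓡 d, M; ℝ⟯ (range s) := hs ▸ trivial
  induction hq using Submodule.span_induction with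
  | mem q hq => obtain ⟨i, rfl⟩ := hq; exact Submodule.subset_span ⟨i, rfl⟩
  | zero => rw [map_zero]; exact Submodule.zero_mem _
  | add q q' _ _ h h' => rw [map_add]; exact Submodule.add_mem _ (h trivial) (h' trivial)
  | smul f q _ h => rw [cls_smul]; exact Submodule.smul_mem _ _ (h trivial)

end FiberAt

section QuotientBundle

variable {d : ℕ} {M : Type u} [TopologicalSpace M] [ChartedSpace (EuclideanSpace ℝ (Fin d)) M]
  {Q : Type v} [AddCommGroup Q] [Module C^∞⟮𝓡 d, M; ℝ⟯ Q] {ι : Type} [Fintype ι]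

/-- The diffeology on the union of the fibers of `Q` in which plots are locally linear combinations,
with smooth coefficients, of the classes of the generators `s`. -/
@[reducible]
def fiberDiffeology (s : ι → Q) (hs : Submodule.span C^∞⟮𝓡 d, M; ℝ⟯ (range s) = ⊤) :
    DiffeologicalSpace (Σ m : M, FiberAt d Q m) where
  plots n := {P | ContMDiff (𝓡 n) (𝓡 d) ∞ (fun t => (P t).1) ∧
    ∀ r, ∃ c : EuclideanSpace ℝ (Fin n) → ι → ℝ, ContDiffNear c r ∧
      ∀ᶠ t in 𝓝 r, (P t).2 = ∑ i, c t i • cls d (P t).1 (s i)}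
  constant_plots x := by
    refine ⟨contMDiff_const, fun r => ?_⟩
    have hx : x.2 ∈ Submodule.span ℝ (range fun i => cls d x.1 (s i)) :=
      span_range_cls hs ▸ trivial
    obtain ⟨c, hc⟩ := (Submodule.mem_span_range_iff_exists_fun ℝ).1 hx
    exact ⟨fun _ => c, contDiff_const.contDiffNear r, Eventually.of_forall fun _ => hc.symm⟩
  plot_reparam := fun {n m p f} hp hf => by
    refine ⟨hp.1.comp hf.contMDiff, fun r => ?_⟩
    obtain ⟨c, hc, hcp⟩ := hp.2 (f r)
    exact ⟨fun t => c (f t), ContDiffNear.comp hc (hf.contDiffNear r),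
      hf.continuous.continuousAt.eventually hcp⟩
  locality := fun {n p} h => by
    have key : ∀ r, ∃ P : EuclideanSpace ℝ (Fin n) → Σ m : M, FiberAt d Q m,
        (ContMDiff (𝓡 n) (𝓡 d) ∞ (fun t => (P t).1) ∧
        ∀ r, ∃ c : EuclideanSpace ℝ (Fin n) → ι → ℝ, ContDiffNear c r ∧
          ∀ᶠ t in 𝓝 r, (P t).2 = ∑ i, c t i • cls d (P t).1 (s i)) ∧ p =ᶠ[𝓝 r] P := by
      intro r
      obtain ⟨O, hO, hr, H⟩ := h r
      obtain ⟨ρ, h1, h2, h3⟩ := exists_contDiff_eventuallyEq_id (hO.mem_nhds hr)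
      exact ⟨p ∘ ρ, H h2 h1, by filter_upwards [h3] with t ht; simp [ht]⟩
    refine ⟨fun r => ?_, fun r => ?_⟩
    · obtain ⟨P, hP, hpP⟩ := key r
      exact hP.1.contMDiffAt.congr_of_eventuallyEq (hpP.mono fun t ht => congrArg Sigma.fst ht)
    · obtain ⟨P, hP, hpP⟩ := key r
      obtain ⟨c, hc, hcP⟩ := hP.2 r
      refine ⟨c, hc, ?_⟩
      filter_upwards [hcP, hpP] with t h1 h2
      rw [h2, h1]

/-- The bundle of the fibers `Q / I_m Q` of a finitely generated module `Q`. -/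
def fiberBundle (s : ι → Q) (hs : Submodule.span C^∞⟮𝓡 d, M; ℝ⟯ (range s) = ⊤) :
    BundleOver.{u, v} d M where
  fiber m := FiberAt d Q m
  diffeology := fiberDiffeology s hs
  smooth_proj := by
    let := fiberDiffeology s hs
    exact fun n P hP => hP.1
  smooth_zero := by
    let := fiberDiffeology s hs
    refine fun n p hp => ⟨hp, fun r => ⟨fun _ _ => 0, contDiff_const.contDiffNear r, ?_⟩⟩
    exact Eventually.of_forall fun t => by simp
  smooth_add := by
    let := fiberDiffeology s hs
    rintro n P ⟨⟨hP1, hP⟩, -, hP'⟩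
    refine ⟨hP1, fun r => ?_⟩
    obtain ⟨c, hc, hcP⟩ := hP r
    obtain ⟨c', hc', hcP'⟩ := hP' r
    refine ⟨fun t => c t + c' t, by filter_upwards [hc, hc'] with t h h' using h.add h', ?_⟩
    filter_upwards [hcP, hcP'] with t h h'
    simp only [Function.comp_apply] at h h' ⊢
    rw [h, h', ← Finset.sum_add_distrib]
    exact Finset.sum_congr rfl fun i _ => (add_smul _ _ _).symm
  smooth_smul := by
    let := fiberDiffeology s hs
    rintro n P ⟨hl, hP1, hP⟩
    refine ⟨hP1, fun r => ?_⟩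
    obtain ⟨c, hc, hcP⟩ := hP r
    have hl' : ContDiff ℝ ∞ (fun t => (P t).1) := IsPlot.contDiff hl
    refine ⟨fun t => (P t).1 • c t, ?_, ?_⟩
    · filter_upwards [hc] with t h using hl'.contDiffAt.smul h
    · filter_upwards [hcP] with t h
      simp only [Function.comp_apply] at h ⊢
      rw [h, Finset.smul_sum]
      exact Finset.sum_congr rfl fun i _ => by rw [smul_smul]; rfl

variable {s : ι → Q} {hs : Submodule.span C^∞⟮𝓡 d, M; ℝ⟯ (range s) = ⊤}
  {V : Type*} [NormedAddCommGroup V] [NormedSpace ℝ V] [FiniteDimensional ℝ V]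

/-- The class of `q`, as a vector of the bundle of fibers. -/
def clsVec (s : ι → Q) (hs : Submodule.span C^∞⟮𝓡 d, M; ℝ⟯ (range s) = ⊤) (m : M) (q : Q) :
    (fiberBundle s hs).fiber m := cls d m q

/-- Plots on any finite-dimensional space are locally combinations of the generators. -/
theorem exists_coeff_of_isPlotAt {f : V → (fiberBundle s hs).Total} {v : V} (hf : IsPlotAt f v) :
    ∃ c : V → ι → ℝ, ContDiffNear c v ∧
      ∀ᶠ w in 𝓝 v, (f w).2 = ∑ i, c w i • clsVec s hs (f w).1 (s i) := by
  obtain ⟨n, ⟨e⟩⟩ := exists_equiv_euclideanSpace V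
  have h1 : IsPlotAt (fun t => f (e.symm t)) (e v) :=
    hf.comp_of_eq (e.symm.contDiff.contDiffNear _) (by simp)
  obtain ⟨P, hP, hPf⟩ := h1.exists_isPlot
  obtain ⟨c, hc, hcP⟩ := (show IsPlot P from hP).2 (e v)
  refine ⟨fun w => c (e w), ContDiffNear.comp hc (e.contDiff.contDiffNear v), ?_⟩
  filter_upwards [e.continuous.continuousAt.eventually hcP,
    e.continuous.continuousAt.eventually hPf] with w hw hw'
  have h3 : f w = P (e w) := by simpa using hw'
  rw [h3]
  exact hw

theorem isSmoothSection_cls (q : Q) :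
    IsSmoothSection (fiberBundle s hs) (fun m => clsVec s hs m q) := by
  have hq : q ∈ Submodule.span C^∞⟮𝓡 d, M; ℝ⟯ (range s) := hs ▸ trivial
  obtain ⟨g, rfl⟩ := (Submodule.mem_span_range_iff_exists_fun _).1 hq
  intro n p hp
  have hp' : ContMDiff (𝓡 n) (𝓡 d) ∞ p := hp
  refine ⟨hp', fun r => ⟨fun t i => g i (p t), ContDiff.contDiffNear ?_ r, ?_⟩⟩
  · exact contDiff_pi.2 fun i => ((g i).contMDiff.comp hp').contDiff
  · exact Eventually.of_forall fun t => cls_sum g s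

/-- The finite family `b` generates `Q` after localization at a function that does not vanish at
`y`. -/
def LocallySpans (d : ℕ) {M : Type u} [TopologicalSpace M]
    [ChartedSpace (EuclideanSpace ℝ (Fin d)) M] {Q : Type v} [AddCommGroup Q]
    [Module C^∞⟮𝓡 d, M; ℝ⟯ Q] {κ : Type} (b : κ → Q) (y : M) : Prop :=
  ∃ D : C^∞⟮𝓡 d, M; ℝ⟯, D y ≠ 0 ∧ ∀ q, D • q ∈ Submodule.span C^∞⟮𝓡 d, M; ℝ⟯ (range b)

theorem locallySpans_of_span_eq_top {κ : Type} {b : κ → Q}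
    (hb : Submodule.span C^∞⟮𝓡 d, M; ℝ⟯ (range b) = ⊤) (y : M) : LocallySpans d b y :=
  ⟨1, one_ne_zero, fun _ => hb ▸ trivial⟩

/-- By Nakayama's lemma, elements of `Q` whose classes span the fiber at `m` generate near `m`. -/
theorem eventually_locallySpans (hs : Submodule.span C^∞⟮𝓡 d, M; ℝ⟯ (range s) = ⊤) {κ : Type}
    [Fintype κ] {b : κ → Q} {m : M}
    (hb : Submodule.span ℝ (range fun i => cls d m (b i)) = ⊤) :
    ∀ᶠ y in 𝓝 m, LocallySpans d b y := by
  set S := Submodule.span C^∞⟮𝓡 d, M; ℝ⟯ (range b)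
  have hfg : (⊤ : Submodule C^∞⟮𝓡 d, M; ℝ⟯ (Q ⧸ S)).FG := by
    have : Module.Finite C^∞⟮𝓡 d, M; ℝ⟯ Q := ⟨⟨(finite_range s).toFinset, by simpa using hs⟩⟩
    exact Module.Finite.fg_top
  have hle : (⊤ : Submodule C^∞⟮𝓡 d, M; ℝ⟯ (Q ⧸ S)) ≤ vanishingIdeal d m • ⊤ := by
    rintro x -
    obtain ⟨q, rfl⟩ := Submodule.mkQ_surjective S x
    have hq : cls d m q ∈ Submodule.span ℝ (range fun i => cls d m (b i)) := hb ▸ trivial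
    obtain ⟨c, hc⟩ := (Submodule.mem_span_range_iff_exists_fun ℝ).1 hq
    let q' : Q := ∑ i, algebraMap ℝ C^∞⟮𝓡 d, M; ℝ⟯ (c i) • b i
    have h1 : q - q' ∈ vanishingIdeal d m • (⊤ : Submodule C^∞⟮𝓡 d, M; ℝ⟯ Q) := by
      rw [← cls_eq_zero_iff, map_sub, sub_eq_zero, ← hc, cls_sum]
      rfl
    have h2 : S.mkQ q' = 0 := (Submodule.Quotient.mk_eq_zero _).2
      (Submodule.sum_mem _ fun i _ => Submodule.smul_mem _ _ (Submodule.subset_span ⟨i, rfl⟩))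
    have h3 : S.mkQ (q - q') ∈ vanishingIdeal d m • (⊤ : Submodule C^∞⟮𝓡 d, M; ℝ⟯ (Q ⧸ S)) := by
      have := Submodule.mem_map_of_mem (f := S.mkQ) h1
      rw [Submodule.map_smul''] at this
      exact Submodule.smul_mono le_rfl le_top this
    rwa [map_sub, h2, sub_zero] at h3
  obtain ⟨D, hD, hD0⟩ := Submodule.exists_sub_one_mem_and_smul_eq_zero_of_fg_of_le_smul _ _ hfg hle
  have hDm : D m = 1 := sub_eq_zero.1 (show (D - 1) m = 0 from hD)
  filter_upwards [D.contMDiff.continuous.continuousAt.eventually_ne (hDm ▸ one_ne_zero)] with y hy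
  refine ⟨D, hy, fun q => ?_⟩
  rw [← Submodule.Quotient.mk_eq_zero]
  exact hD0 (S.mkQ q) trivial

end QuotientBundle

/-! ### Coefficients of plots of the bundle of fibers -/

section Lift

variable {d : ℕ} {M : Type u} [TopologicalSpace M] [ChartedSpace (EuclideanSpace ℝ (Fin d)) M]
  {Q : Type v} [AddCommGroup Q] [Module C^∞⟮𝓡 d, M; ℝ⟯ Q] {ι : Type} [Fintype ι]
  {s : ι → Q} {hs : Submodule.span C^∞⟮𝓡 d, M; ℝ⟯ (range s) = ⊤}
  {V : Type*} [NormedAddCommGroup V] [NormedSpace ℝ V] [FiniteDimensional ℝ V]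

theorem contDiffNear_comp_fst {E : BundleOver.{u, v} d M} {f : V → E.Total} {v : V}
    (hf : IsPlotAt f v) (g : C^∞⟮𝓡 d, M; ℝ⟯) : ContDiffNear (fun w => g (f w).1) v := by
  filter_upwards [contMDiffAt_fst_of_isPlotAt hf] with w hw
  exact (g.contMDiff.contMDiffAt.comp w hw).contDiffAt

/-- Plots of the bundle of fibers lift to coefficients with respect to a locally generating family
`b`, with a prescribed value at one point. A linear relation between the classes of `b` in one
fiber prolongs to a smooth family of relations, which is used to correct the value. -/
theorem exists_coeff_of_locallySpans {f : V → (fiberBundle s hs).Total} {v : V} (hf : IsPlotAt f v)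
    {κ : Type} [Fintype κ] {b : κ → Q} (hb : LocallySpans d b (f v).1) {τ : κ → ℝ}
    (hτ : (f v).2 = ∑ i, τ i • clsVec s hs (f v).1 (b i)) :
    ∃ c : V → κ → ℝ, ContDiffNear c v ∧ c v = τ ∧
      ∀ᶠ w in 𝓝 v, (f w).2 = ∑ i, c w i • clsVec s hs (f w).1 (b i) := by
  obtain ⟨D, hD, hDb⟩ := hb
  obtain ⟨c, hc, hcf⟩ := exists_coeff_of_isPlotAt hf
  choose F hF using fun a => (Submodule.mem_span_range_iff_exists_fun _).1 (hDb (s a))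
  have hDy : ∀ᶠ w in 𝓝 v, D (f w).1 ≠ 0 :=
    (contDiffNear_comp_fst hf D).continuousAt.eventually_ne hD
  have hs' : ∀ z, D z ≠ 0 → ∀ a, clsVec s hs z (s a) =
      ∑ i, (F a i z / D z) • clsVec s hs z (b i) := by
    intro z hz a
    have h : D z • clsVec s hs z (s a) = ∑ i, F a i z • clsVec s hs z (b i) :=
      (cls_smul D (s a)).symm.trans ((congrArg _ (hF a).symm).trans (cls_sum _ _))
    rw [← inv_smul_smul₀ hz (clsVec s hs z (s a)), h, Finset.smul_sum]
    exact Finset.sum_congr rfl fun i _ => by rw [smul_smul, div_eq_inv_mul]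
  let c₁ : V → κ → ℝ := fun w i => ∑ a, c w a * (F a i (f w).1 / D (f w).1)
  have hc₁ : ∀ᶠ w in 𝓝 v, (f w).2 = ∑ i, c₁ w i • clsVec s hs (f w).1 (b i) := by
    filter_upwards [hcf, hDy] with w hw hDw
    simp only [hw, hs' _ hDw, Finset.smul_sum, c₁, Finset.sum_smul, smul_smul]
    exact Finset.sum_comm
  let δ : κ → ℝ := c₁ v - τ
  -- The relation `δ` in the fiber prolongs to the relations `G / D - δ` near it.
  obtain ⟨G, hG, hGb⟩ : ∃ G : κ → C^∞⟮𝓡 d, M; ℝ⟯, (∀ i, G i (f v).1 = 0) ∧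
      ∀ z, D z • ∑ i, δ i • clsVec s hs z (b i) = ∑ i, G i z • clsVec s hs z (b i) := by
    let q : Q := ∑ i, algebraMap ℝ C^∞⟮𝓡 d, M; ℝ⟯ (δ i) • b i
    have hq : ∀ z, clsVec s hs z q = ∑ i, δ i • clsVec s hs z (b i) := fun z => cls_sum _ _
    have h0 : q ∈ vanishingIdeal d (f v).1 • (⊤ : Submodule C^∞⟮𝓡 d, M; ℝ⟯ Q) := by
      rw [← cls_eq_zero_iff]
      refine (hq _).trans ?_
      simp only [δ, Pi.sub_apply, sub_smul, Finset.sum_sub_distrib]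
      rw [← hτ, ← hc₁.self_of_nhds]
      exact sub_self _
    have h1 : D • q ∈ vanishingIdeal d (f v).1 •
        Submodule.span C^∞⟮𝓡 d, M; ℝ⟯ (range b) := by
      refine Submodule.smul_induction_on h0 (fun g hg x _ => ?_) fun x y hx hy => ?_
      · rw [smul_comm]
        exact Submodule.smul_mem_smul hg (hDb x)
      · rw [smul_add]
        exact Submodule.add_mem _ hx hy
    obtain ⟨a, ha, hab⟩ := (Submodule.mem_ideal_smul_span_iff_exists_sum _ _ _).1 h1
    rw [Finsupp.sum_fintype _ _ (by simp)] at hab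
    refine ⟨a, fun i => ha i, fun z => ?_⟩
    rw [← hq]
    exact (cls_smul D q).symm.trans ((congrArg _ hab.symm).trans (cls_sum _ _))
  refine ⟨fun w i => c₁ w i - δ i + G i (f w).1 / D (f w).1, ?_, ?_, ?_⟩
  · have hF' : ∀ᶠ w in 𝓝 v, ∀ a i, ContDiffAt ℝ ∞ (fun w => F a i (f w).1) w :=
      eventually_all.2 fun a => eventually_all.2 fun i => contDiffNear_comp_fst hf _
    have hG' : ∀ᶠ w in 𝓝 v, ∀ i, ContDiffAt ℝ ∞ (fun w => G i (f w).1) w :=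
      eventually_all.2 fun i => contDiffNear_comp_fst hf _
    filter_upwards [hF', hG', hDy, contDiffNear_comp_fst hf D, hc] with w h1 h2 h3 h4 h5
    refine contDiffAt_pi.2 fun i => ((ContDiffAt.sum fun a _ => ?_).sub contDiffAt_const).add
      ((h2 i).div h4 h3)
    exact (contDiffAt_pi.1 h5 a).mul ((h1 a i).div h4 h3)
  · funext i
    simp [hG, δ]
  · filter_upwards [hc₁, hDy] with w hw hDw
    have h : ∑ i, (G i (f w).1 / D (f w).1) • clsVec s hs (f w).1 (b i) =
        ∑ i, δ i • clsVec s hs (f w).1 (b i) := by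
      rw [← inv_smul_smul₀ hDw (∑ i, δ i • clsVec s hs (f w).1 (b i)), hGb, Finset.smul_sum]
      exact Finset.sum_congr rfl fun i _ => by rw [smul_smul, div_eq_inv_mul]
    simp only [add_smul, sub_smul, Finset.sum_add_distrib, Finset.sum_sub_distrib]
    rw [h, ← hw, sub_add_cancel]

/-- Every vector over `y` is a combination of classes of a locally generating family. -/
theorem exists_eq_sum_of_locallySpans {κ : Type} [Fintype κ] {b : κ → Q} {y : M}
    (hb : LocallySpans d b y) (e : (fiberBundle s hs).fiber y) :
    ∃ τ : κ → ℝ, e = ∑ i, τ i • clsVec s hs y (b i) := by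
  obtain ⟨D, hD, hDb⟩ := hb
  obtain ⟨q, rfl⟩ : ∃ q, clsVec s hs y q = e := cls_surjective e
  obtain ⟨F, hF⟩ := (Submodule.mem_span_range_iff_exists_fun _).1 (hDb q)
  have h : D y • clsVec s hs y q = ∑ i, F i y • clsVec s hs y (b i) :=
    (cls_smul D q).symm.trans ((congrArg _ hF.symm).trans (cls_sum _ _))
  refine ⟨fun i => (D y)⁻¹ * F i y, ?_⟩
  rw [← inv_smul_smul₀ hD (clsVec s hs y q), h, Finset.smul_sum]
  exact Finset.sum_congr rfl fun i _ => smul_smul _ _ _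

end Lift

/-! ### The bundle of fibers is a VB-tepui -/

section FiberBundleTepui

variable {d : ℕ} {M : Type u} [TopologicalSpace M] [ChartedSpace (EuclideanSpace ℝ (Fin d)) M]
  {Q : Type v} [AddCommGroup Q] [Module C^∞⟮𝓡 d, M; ℝ⟯ Q] {ι : Type} [Fintype ι]
  {s : ι → Q} {hs : Submodule.span C^∞⟮𝓡 d, M; ℝ⟯ (range s) = ⊤}
  {V : Type*} [NormedAddCommGroup V] [NormedSpace ℝ V] [FiniteDimensional ℝ V]
  {κ : Type} [Fintype κ]

/-- The linear combination of the classes of `b` at `y` with coefficients `τ`. -/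
def comb (s : ι → Q) (hs : Submodule.span C^∞⟮𝓡 d, M; ℝ⟯ (range s) = ⊤) (b : κ → Q) (y : M)
    (τ : κ → ℝ) : (fiberBundle s hs).Total :=
  ⟨y, ∑ i, τ i • clsVec s hs y (b i)⟩

theorem isPlotAt_comb (b : κ → Q) {p : V → M} {c : V → κ → ℝ} {v : V}
    (hp : ∀ᶠ x in 𝓝 v, ContMDiffAt 𝓘(ℝ, V) (𝓡 d) ∞ p x) (hc : ContDiffNear c v) :
    IsPlotAt (fun x => comb s hs b (p x) (c x)) v := by
  refine isPlotAt_sum (E := fiberBundle s hs) (y := p)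
    (a := fun i x => c x i • clsVec s hs (p x) (b i)) Finset.univ
    (isPlotAt_manifold_iff.2 hp) fun i _ => ?_
  refine isPlotAt_smul (E := fiberBundle s hs) (f := fun x => ⟨p x, clsVec s hs (p x) (b i)⟩)
    (c := fun x => c x i) ((isSmoothSection_cls (b i)).isPlotAt hp) ?_
  filter_upwards [hc] with x hx using contDiffAt_pi.1 hx i

theorem exists_comb_lift {f : V → (fiberBundle s hs).Total} {v : V} (hf : IsPlotAt f v)
    {b : κ → Q} {y : M} (hb : LocallySpans d b y) {τ : κ → ℝ} (hτ : f v = comb s hs b y τ) :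
    ∃ c : V → κ → ℝ, ContDiffNear c v ∧ c v = τ ∧
      ∀ᶠ w in 𝓝 v, f w = comb s hs b (f w).1 (c w) := by
  have hy : (f v).1 = y := congrArg Sigma.fst hτ
  subst hy
  obtain ⟨c, hc, hcv, hcf⟩ := exists_coeff_of_locallySpans hf hb (τ := τ)
    (total_snd_eq (s := fun y => ∑ i, τ i • clsVec s hs y (b i)) hτ)
  exact ⟨c, hc, hcv, hcf.mono fun w hw => Sigma.ext rfl (heq_of_eq hw)⟩

theorem exists_comb_eq {b : κ → Q} (x : (fiberBundle s hs).Total) (hb : LocallySpans d b x.1) :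
    ∃ τ, x = comb s hs b x.1 τ := by
  obtain ⟨τ, hτ⟩ := exists_eq_sum_of_locallySpans hb x.2
  exact ⟨τ, Sigma.ext rfl (heq_of_eq hτ)⟩

/-- Plots of `M` lift to combinations of the generators with constant coefficients. -/
theorem isLocalSubduction_proj_fiberBundle :
    letI := manifoldDiffeology d M
    IsLocalSubduction (fiberBundle s hs).proj := by
  let := manifoldDiffeology d M
  refine ⟨isPlotwiseSubmersion_of_exists_lift (fiberBundle s hs).smooth_proj
    fun x n f r hf hr => ?_, fun y => ⟨⟨y, 0⟩, rfl⟩⟩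
  obtain ⟨τ, hτ⟩ := exists_comb_eq x (locallySpans_of_span_eq_top hs x.1)
  refine ⟨fun t => comb s hs s (f t) τ, isPlotAt_comb s (isPlotAt_manifold_iff.1 hf)
    (contDiff_const.contDiffNear r), ?_, Eventually.of_forall fun t => rfl⟩
  change comb s hs s (f r) τ = x
  rw [hr]
  exact hτ.symm

/-- The total space is second countable, because the combinations of the generators define a
continuous open map from `M × ℝ^ι` onto it. -/
theorem secondCountable_fiberBundle [IsManifold (𝓡 d) ∞ M] [SecondCountableTopology M] :
    @SecondCountableTopology (fiberBundle s hs).Total dTopology := by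
  let := dTopology (X := (fiberBundle s hs).Total)
  let Φ : M × (ι → ℝ) → (fiberBundle s hs).Total := fun z => comb s hs s z.1 z.2
  have hΦc : Continuous Φ := by
    refine continuous_def.2 fun A hA => isOpen_iff_mem_nhds.2 fun ⟨m, τ⟩ hmτ => ?_
    let ψ := chartAt (EuclideanSpace ℝ (Fin d)) m
    have hψm : ψ.symm (ψ m) = m := ψ.left_inv (mem_chart_source _ m)
    have hsm : ∀ᶠ z in 𝓝 (ψ m, τ),
        ContMDiffAt 𝓘(ℝ, EuclideanSpace ℝ (Fin d) × (ι → ℝ)) (𝓡 d) ∞ (fun z => ψ.symm z.1) z := by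
      filter_upwards [(continuous_fst.tendsto (ψ m, τ)).eventually
        (eventually_chart_symm (m := m))] with z hz
      exact hz.2.comp z contDiff_fst.contMDiff.contMDiffAt
    have h1 := (isPlotAt_comb (s := s) (hs := hs) s (c := Prod.snd) hsm
      (contDiff_snd.contDiffNear _)).eventually_mem hA (by
        change comb s hs s (ψ.symm (ψ m)) τ ∈ A
        rw [hψm]
        exact hmτ)
    have h2 : Tendsto (fun z : M × (ι → ℝ) => (ψ z.1, z.2)) (𝓝 (m, τ)) (𝓝 (ψ m, τ)) :=
      ((ψ.continuousAt (mem_chart_source _ m)).tendsto.comp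
        (continuous_fst.tendsto (m, τ))).prodMk_nhds (continuous_snd.tendsto (m, τ))
    filter_upwards [h2.eventually h1, (continuous_fst.tendsto (m, τ)).eventually
      (ψ.open_source.mem_nhds (mem_chart_source _ m))] with z hz hz'
    rw [ψ.left_inv hz'] at hz
    exact hz
  have hΦo : IsOpenMap Φ := by
    refine fun O hO => isOpen_iff_preimages_plots.2 fun n P hP => isOpen_iff_mem_nhds.2 ?_
    rintro r ⟨⟨y, τ⟩, hyτ, hr⟩
    obtain ⟨c, hc, hcr, hcP⟩ := exists_comb_lift (hP.isPlotAt r)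
      (locallySpans_of_span_eq_top hs y) hr.symm
    have hy : (P r).1 = y := congrArg Sigma.fst hr.symm
    have h1 : ContinuousAt (fun t => ((P t).1, c t)) r :=
      (contMDiffAt_fst_of_isPlotAt (hP.isPlotAt r)).self_of_nhds.continuousAt.prodMk
        hc.continuousAt
    have h2 : ∀ᶠ t in 𝓝 r, ((P t).1, c t) ∈ O :=
      h1.eventually (hO.mem_nhds (by
        change ((P r).1, c r) ∈ O
        rw [hy, hcr]
        exact hyτ))
    filter_upwards [hcP, h2] with t ht ht'
    exact ⟨_, ht', ht.symm⟩
  have hΦs : Function.Surjective Φ := fun x =>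
    let ⟨τ, hτ⟩ := exists_comb_eq x (locallySpans_of_span_eq_top hs x.1)
    ⟨(x.1, τ), hτ.symm⟩
  exact (hΦo.isQuotientMap hΦc hΦs).secondCountableTopology hΦo

/-- The fibers carry the topology of a linear subspace of `ℝ^ι`, given by a choice of coefficients
that is linear. -/
theorem exists_isEmbedding_fiber (y : M) :
    ∃ g : {x // (fiberBundle s hs).proj x = y} → ι → ℝ,
      @IsEmbedding _ _ (dTopology (X := {x // (fiberBundle s hs).proj x = y})) _ g := by
  let := dTopology (X := {x // (fiberBundle s hs).proj x = y})
  let S : (ι → ℝ) →ₗ[ℝ] (fiberBundle s hs).fiber y :=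
    Fintype.linearCombination ℝ fun i => clsVec s hs y (s i)
  have hS : LinearMap.range S = ⊤ := by
    rw [Fintype.range_linearCombination]
    exact span_range_cls hs
  obtain ⟨R, hR⟩ := S.exists_rightInverse_of_surjective hS
  have hSR : ∀ e, S (R e) = e := fun e => LinearMap.congr_fun hR e
  let g : {x // (fiberBundle s hs).proj x = y} → ι → ℝ := fun x => R (fiberValue y x.1)
  let h : (ι → ℝ) → {x // (fiberBundle s hs).proj x = y} := fun τ => ⟨comb s hs s y τ, rfl⟩
  have hSh : ∀ τ, (h τ).1 = ⟨y, S τ⟩ := fun τ => rfl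
  refine ⟨g, Function.LeftInverse.isEmbedding (f := h) (fun x => Subtype.ext ?_) ?_ ?_⟩
  · rw [hSh, hSR]
    exact mk_fiberValue x.2
  · refine continuous_def.2 fun A hA => isOpen_iff_mem_nhds.2 fun τ hτ => ?_
    have h1 : IsPlotAt h τ := isPlotAt_induced_iff.2
      (isPlotAt_comb s (p := fun _ : ι → ℝ => y) (c := id)
        (Eventually.of_forall fun _ => contMDiffAt_const) (contDiff_id.contDiffNear _))
    exact h1.eventually_mem hA hτ
  · refine continuous_def.2 fun A hA => isOpen_iff_preimages_plots.2 fun n P hP =>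
      isOpen_iff_mem_nhds.2 fun r hr => ?_
    have hP' : IsPlotAt (fun t => (P t).1) r := isPlotAt_induced_iff.1 (hP.isPlotAt r)
    obtain ⟨c, hc, hcP⟩ := exists_coeff_of_isPlotAt hP'
    have h1 : ∀ᶠ t in 𝓝 r, g (P t) = R (S (c t)) := by
      filter_upwards [hcP] with t ht
      have h2 : (P t).1 = ⟨y, S (c t)⟩ := by
        have h3 : (P t).1.1 = y := (P t).2
        generalize (P t).1 = x at h3 ht
        subst h3
        exact Sigma.ext rfl (heq_of_eq ht)
      change R (fiberValue y (P t).1) = _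
      rw [h2, fiberValue_mk]
    have h2 : ContinuousAt (fun t => R (S (c t))) r :=
      (LinearMap.continuous_of_finiteDimensional (R ∘ₗ S)).continuousAt.comp hc.continuousAt
    filter_upwards [h1, h2.eventually (hA.mem_nhds (by
      change R (S (c r)) ∈ A
      rw [← h1.self_of_nhds]
      exact hr))] with t ht ht'
    rw [← ht] at ht'
    exact ht'

theorem isOpen_locallySpans {κ : Type} (b : κ → Q) : IsOpen {y : M | LocallySpans d b y} :=
  isOpen_iff_mem_nhds.2 fun y ⟨D, hD, hDb⟩ => by
    filter_upwards [D.contMDiff.continuous.continuousAt.eventually_ne hD] with z hz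
    exact ⟨D, hz, hDb⟩

/-- Lifts of a basis of the fiber at `m` give a chart of the total space that is minimal at the
vectors over `m`. -/
theorem exists_minimalChart_fiberBundle [IsManifold (𝓡 d) ∞ M] (x : (fiberBundle s hs).Total) :
    letI := manifoldDiffeology d M
    ∃ (n : ℕ) (U : Opens (EuclideanSpace ℝ (Fin n))) (p : U → (fiberBundle s hs).Total),
      IsMinimalChartAt (fiberBundle s hs).proj x p := by
  classical
  let := manifoldDiffeology d M
  set m := x.1
  have : FiniteDimensional ℝ (FiberAt d Q m) :=
    ⟨⟨(finite_range _).toFinset, by rw [Finite.coe_toFinset]; exact span_range_cls hs⟩⟩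
  let B := Module.finBasis ℝ (FiberAt d Q m)
  choose b hb using fun i => cls_surjective (B i)
  have hbm : ∀ᶠ y in 𝓝 m, LocallySpans d b y := eventually_locallySpans hs (by
    simp only [hb]
    exact B.span_eq)
  let κ := Fin (Module.finrank ℝ (FiberAt d Q m))
  let ψ := chartAt (EuclideanSpace ℝ (Fin d)) m
  have hψm : ψ.symm (ψ m) = m := ψ.left_inv (mem_chart_source _ m)
  obtain ⟨n, ⟨e'⟩⟩ := exists_equiv_euclideanSpace (EuclideanSpace ℝ (Fin d) × (κ → ℝ))
  obtain ⟨e⟩ : Nonempty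
      (EuclideanSpace ℝ (Fin n) ≃L[ℝ] EuclideanSpace ℝ (Fin d) × (κ → ℝ)) := ⟨e'.symm⟩
  -- The chart sends `(x, τ)` to the combination of the `b i` with coefficients `τ` at the point
  -- with coordinates `x`, over the open set where the `b i` generate `Q`.
  let O : Set (EuclideanSpace ℝ (Fin d)) := ψ.target ∩ ψ.symm ⁻¹' {y | LocallySpans d b y}
  have hO : IsOpen O := ψ.isOpen_inter_preimage_symm (isOpen_locallySpans b)
  let U : Opens (EuclideanSpace ℝ (Fin n)) :=
    ⟨{u | (e u).1 ∈ O}, hO.preimage (continuous_fst.comp e.continuous)⟩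
  let P : EuclideanSpace ℝ (Fin n) → (fiberBundle s hs).Total :=
    fun u => comb s hs b (ψ.symm (e u).1) (e u).2
  have hP : ∀ u ∈ U, IsPlotAt P u := fun u hu => by
    refine isPlotAt_comb b ?_ (ContDiff.contDiffNear ?_ u)
    · filter_upwards [U.2.mem_nhds hu] with t ht
      exact (contMDiffAt_chart_symm_of_mem_target ht.1).comp t
        (contDiff_fst.comp e.contDiff).contMDiff.contMDiffAt
    · exact contDiff_snd.comp e.contDiff
  obtain ⟨τ, hτ⟩ := exists_comb_eq x hbm.self_of_nhds
  have hsub : DSmooth (fun u : U => P u) := dSmooth_opens_of_isPlotAt hP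
  refine ⟨n, U, fun u => P u, hsub, ⟨⟨e.symm (ψ m, τ), ?_⟩, ?_⟩,
    isPlotwiseSubmersion_of_exists_lift hsub ?_, ?_⟩
  · change (e (e.symm (ψ m, τ))).1 ∈ O
    rw [e.apply_symm_apply]
    refine ⟨ψ.map_source (mem_chart_source _ m), ?_⟩
    change LocallySpans d b (ψ.symm (ψ m))
    rw [hψm]
    exact hbm.self_of_nhds
  · change comb s hs b (ψ.symm (e (e.symm (ψ m, τ))).1) (e (e.symm (ψ m, τ))).2 = x
    rw [e.apply_symm_apply, hτ]
    exact congrArg (fun y => comb s hs b y τ) hψm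
  · intro u k f r hf hr
    obtain ⟨c, hc, hcr, hcf⟩ := exists_comb_lift hf u.2.2 hr
    have hfr : (f r).1 = ψ.symm (e u).1 := congrArg Sigma.fst hr
    have hsrc : ∀ᶠ t in 𝓝 r, (f t).1 ∈ ψ.source :=
      (contMDiffAt_fst_of_isPlotAt hf).self_of_nhds.continuousAt.eventually
        (ψ.open_source.mem_nhds (by
          change (f r).1 ∈ ψ.source
          rw [hfr]
          exact ψ.map_target u.2.1))
    let q : EuclideanSpace ℝ (Fin k) → EuclideanSpace ℝ (Fin n) :=
      fun t => e.symm (ψ (f t).1, c t)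
    have hq : ContDiffNear q r := by
      filter_upwards [contMDiffAt_fst_of_isPlotAt hf, hsrc, hc] with t h1 h2 h3
      refine e.symm.contDiff.contDiffAt.comp t (ContDiffAt.prodMk ?_ h3)
      exact ((contMDiffOn_chart.contMDiffAt (ψ.open_source.mem_nhds h2)).comp t h1).contDiffAt
    have hqr : q r = u := by
      change e.symm (ψ (f r).1, c r) = u
      rw [hfr, hcr, ψ.right_inv u.2.1]
      exact e.symm_apply_apply u
    have hqU : ∀ᶠ t in 𝓝 r, q t ∈ U := hq.continuousAt.eventually (U.2.mem_nhds (hqr ▸ u.2))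
    have hqe : ∀ᶠ t in 𝓝 r,
        ((if h : q t ∈ U then ⟨q t, h⟩ else u : U) : EuclideanSpace ℝ (Fin n)) = q t :=
      hqU.mono fun t ht => by rw [dif_pos ht]
    refine ⟨fun t => if h : q t ∈ U then ⟨q t, h⟩ else u, isPlotAt_opens_iff.2 (hq.congr hqe),
      Subtype.ext (hqe.self_of_nhds.trans hqr), ?_⟩
    filter_upwards [hqe, hcf, hsrc] with t h1 h2 h3
    rw [h1, h2]
    change comb s hs b (ψ.symm (e (e.symm (ψ (f t).1, c t))).1) (e (e.symm (ψ (f t).1, c t))).2 = _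
    rw [e.apply_symm_apply, ψ.left_inv h3]
  · intro u hu u' hu' h
    have key : ∀ u : U, (P u).1 = m → (e u).1 = ψ m := fun u hu => by
      rw [← hu]
      exact (ψ.right_inv u.2.1).symm
    have h1 := key u hu
    have h2 := key u' hu'
    refine Subtype.ext (e.injective (Prod.ext (h1.trans h2.symm) ?_))
    have h3 : comb s hs b (ψ.symm (e u).1) (e u).2 = comb s hs b (ψ.symm (e u').1) (e u').2 := h
    rw [h1, h2, hψm] at h3
    have h4 : ∑ i, (e u).2 i • B i = ∑ i, (e u').2 i • B i := by
      simp only [← hb]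
      exact eq_of_heq (Sigma.ext_iff.1 h3).2
    exact B.linearIndependent.fintypeLinearCombination_injective h4

theorem isVBTepui_fiberBundle [IsManifold (𝓡 d) ∞ M] [SecondCountableTopology M] :
    IsVBTepui (fiberBundle s hs) :=
  let := manifoldDiffeology d M
  { isLocalSubduction := isLocalSubduction_proj_fiberBundle
    secondCountable := secondCountable_fiberBundle
    exists_minimalChart := exists_minimalChart_fiberBundle
    fiber_t2 y := by
      let := dTopology (X := {x // (fiberBundle s hs).proj x = y})
      obtain ⟨g, hg⟩ := exists_isEmbedding_fiber (s := s) (hs := hs) y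
      exact hg.t2Space
    fiber_secondCountable y := by
      let := dTopology (X := {x // (fiberBundle s hs).proj x = y})
      obtain ⟨g, hg⟩ := exists_isEmbedding_fiber (s := s) (hs := hs) y
      exact hg.secondCountableTopology }

theorem hasBoundedRank_fiberBundle : (fiberBundle s hs).HasBoundedRank := by
  refine ⟨Fintype.card ι, fun m => ?_⟩
  have h := rank_span_le (R := ℝ) (range fun i => cls d m (s i))
  rw [span_range_cls hs, rank_top] at h
  have h' := Cardinal.mk_range_le_lift (f := fun i => cls d m (s i))
  simp only [Cardinal.mk_fintype ι, Cardinal.lift_natCast, Cardinal.lift_le_nat_iff] at h'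
  exact h.trans h'

/-- An element of `Q` defines a section of the bundle of fibers. -/
def toSection (s : ι → Q) (hs : Submodule.span C^∞⟮𝓡 d, M; ℝ⟯ (range s) = ⊤) :
    Q →ₗ[C^∞⟮𝓡 d, M; ℝ⟯] SmoothSection (fiberBundle s hs) where
  toFun q := ⟨fun m => clsVec s hs m q, isSmoothSection_cls q⟩
  map_add' q q' := Subtype.ext (funext fun m => map_add (cls d m) q q')
  map_smul' f q := Subtype.ext (funext fun _ => cls_smul f q)

theorem bijective_toSection [IsManifold (𝓡 d) ∞ M] [T2Space M] [SecondCountableTopology M]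
    (hQ : IsFiberDetermined d M Q) : Function.Bijective (toSection s hs) := by
  refine ⟨(injective_iff_map_eq_zero _).2 fun q hq => hQ q
    (congrFun (congrArg Subtype.val hq)), fun τ => ?_⟩
  obtain ⟨f, hf⟩ := exists_eq_sum_of_generatesAt (σ := fun i => toSection s hs (s i))
    (fun _ _ _ _ hP _ => exists_coeff_of_isPlotAt hP) τ
  exact ⟨∑ i, f i • s i, by rw [hf, map_sum]; simp⟩

end FiberBundleTepui

end Tepui

end

theorem proposition2p5 (d : ℕ) (M : Type u) [TopologicalSpace M] [T2Space M]
    [SecondCountableTopology M] [ChartedSpace (EuclideanSpace ℝ (Fin d)) M]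
    [IsManifold (𝓡 d) ∞ M] :
    ∃ h : ∀ E : (Tepui.boundedVBTepui.{u, u} d M).FullSubcategory,
        Tepui.finiteFiberDetermined d M ((Tepui.sectionFunctor d M).obj E.obj),
      ((Tepui.finiteFiberDetermined d M).lift
        ((Tepui.boundedVBTepui d M).ι ⋙ Tepui.sectionFunctor d M) h).IsEquivalence := by
  refine ⟨fun E => ⟨Tepui.finite_smoothSection E.property.1 E.property.2,
    Tepui.isFiberDetermined_smoothSection E.obj⟩, ⟨⟨?_⟩, ⟨?_⟩, ⟨?_⟩⟩⟩
  · intro E E' f g hfg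
    refine ObjectProperty.hom_ext _ (Tepui.pushforward_injective E.property.1 ?_)
    exact congrArg (fun α => α.hom.hom) hfg
  · intro E E' α
    obtain ⟨f, hf⟩ := Tepui.pushforward_surjective E.property.1 E.property.2 α.hom.hom
    refine ⟨ObjectProperty.homMk f, ObjectProperty.hom_ext _ (ModuleCat.hom_ext hf)⟩
  · rintro ⟨Q, hQf, hQ⟩
    obtain ⟨N, s, hs⟩ := Module.Finite.exists_fin (R := C^∞⟮𝓡 d, M; ℝ⟯) (M := Q)
    exact ⟨⟨Tepui.fiberBundle s hs, Tepui.isVBTepui_fiberBundle,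
      Tepui.hasBoundedRank_fiberBundle⟩, ⟨ObjectProperty.isoMk _
        (LinearEquiv.ofBijective _ (Tepui.bijective_toSection hQ)).toModuleIso.symm⟩⟩
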